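/- An \emph{explosive triple} $(M,N,E)$ consists of a smooth manifold $M$, an (embedded) submanifold $N\subseteq M$, and a smooth subbundle $E\subseteq \nu_N M = TM|_N/TN$ of the normal bundle. A \emph{compatible map} $\phi:(M,N,E)\to(M',N',E')$ is a smooth map $\phi:M\to M'$ such that $\phi(N)\subseteq N'$ and $T\phi(E)\subseteq E'$. A \emph{smooth manifold over $\mathbb{R}$} is a smooth manifold $P$ with a smooth map $\hbar:P\to\mathbb{R}$; morphisms are smooth maps commuting with the maps to $\mathbb{R}$. Manifolds are finite-dimensional and locally Euclidean of a fixed dimension, but not necessarily Hausdorff or second countable. An \emph{explosive chart} is an explosive triple $(M,N,E)$ in which $M\subseteq\mathbb{R}^n$ is an open subset, where the coordinates of $\mathbb{R}^n$ are grouped as $(x,y,z)$ (each letter denotes a vector), $N=\{(x,y,z)\in M : y=z=0\}$, and $E$ is spanned by the (classes of the) vectors in the $y$ directions. \textbf{Theorem.} There exist a functor $\mathbb{E}$ from the category of explosive triples and compatible maps to the category of smooth manifolds over $\mathbb{R}$, and a natural transformation $\mathrm{Pr}$ from $\mathbb{E}$ (followed by forgetting the map to $\mathbb{R}$) to the forgetful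 functor $(M,N,E)\mapsto M$, such that: 1. For any explosive chart $(M,N,E)$, up to a diffeomorphism that respects $\mathrm{Pr}$ and $\hbar$, $$\mathbb{E}(M,N,E)=\{(x,y,z,\hbar)\in\mathbb{R}^{n+1} : (x,\hbar y,\hbar^2 z)\in M\},\qquad \mathrm{Pr}(x,y,z,\hbar)=(x,\hbar y,\hbar^2 z),$$ an open submanifold of $\mathbb{R}^{n+1}$, and the projection to $\mathbb{R}$ is the coordinate $\hbar$. 2. For any trivial explosive triple $(M,M,0)$, up to a diffeomorphism that respects $\mathrm{Pr}$ and $\hbar$, $\mathbb{E}(M,M,0)=M\times\mathbb{R}$, $\mathrm{Pr}$ is the Cartesian projection to $M$ and $\hbar$ is the Cartesian projection to $\mathbb{R}$; under these identifications, for any smooth map $\phi:M\to M'$, regarded as a map $(M,M,0)\to(M',M',0)$, one has $\mathbb{E}\phi=\phi\times\mathrm{id}_{\mathbb{R}}$. 3. For any explosive triple $(M,N,E)$, the restriction of $(\mathrm{Pr},\hbar):\mathbb{E}(M,N,E)\to M\times\mathbb{R}$ to the open subset $\hbar\neq0$ is a diffeomorphism onto $M\times\mathbb{R}_*$, where $\mathbb{R}_*=\mathbb{R}\setminus\{0\}$.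 Moreover, if $M$ is Hausdorff then so is $\mathbb{E}(M,N,E)$, and if $M$ is second countable then so is $\mathbb{E}(M,N,E)$. -/

import Mathlib

open CategoryTheory
open scoped Manifold ContDiff

universe u

namespace Explosion

noncomputable section

/-! ### The category of smooth manifolds -/

/-- A smooth (real, finite-dimensional) manifold.  Neither the Hausdorff property nor second
countability is imposed; see the last clauses of the theorem for these. -/
structure SmoothMan : Type (u + 1) where
  carrier : Type u
  dim : ℕ
  [topologicalSpace : TopologicalSpace carrier]
  [chartedSpace : ChartedSpace (EuclideanSpace ℝ (Fin dim)) carrier]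
  [isManifold : IsManifold (𝓡 dim) ∞ carrier]

attribute [instance] SmoothMan.topologicalSpace SmoothMan.chartedSpace SmoothMan.isManifold

instance : CoeSort SmoothMan.{u} (Type u) := ⟨SmoothMan.carrier⟩

/-- The tangent space of `M` at `p`. -/
abbrev SmoothMan.Tangent (M : SmoothMan.{u}) (p : M) : Type := TangentSpace (𝓡 M.dim) p

/-- Smooth maps. -/
@[ext]
structure SmoothMan.Hom (M M' : SmoothMan.{u}) where
  toFun : M → M'
  contMDiff : ContMDiff (𝓡 M.dim) (𝓡 M'.dim) ∞ toFun

/-- The tangent map of a smooth map. -/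
abbrev SmoothMan.Hom.tangentMap {M M' : SmoothMan.{u}} (f : SmoothMan.Hom M M') (p : M) :
    M.Tangent p →L[ℝ] M'.Tangent (f.toFun p) :=
  mfderiv (𝓡 M.dim) (𝓡 M'.dim) f.toFun p

instance : Category SmoothMan.{u} where
  Hom M M' := SmoothMan.Hom M M'
  id M := ⟨id, contMDiff_id⟩
  comp f g := ⟨g.toFun ∘ f.toFun, g.contMDiff.comp f.contMDiff⟩

/-! ### The category of smooth manifolds over `ℝ` -/

/-- A smooth manifold over `ℝ`: a smooth manifold with a smooth map `ħ` to `ℝ`. -/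
structure SmoothManOverReal : Type (u + 1) where
  man : SmoothMan.{u}
  ħ : man → ℝ
  contMDiff_ħ : ContMDiff (𝓡 man.dim) 𝓘(ℝ) ∞ ħ

/-- Smooth maps over `ℝ`. -/
@[ext]
structure SmoothManOverReal.Hom (P P' : SmoothManOverReal.{u}) extends
    SmoothMan.Hom P.man P'.man where
  comm : ∀ p, P'.ħ (toFun p) = P.ħ p

instance : Category SmoothManOverReal.{u} where
  Hom P P' := SmoothManOverReal.Hom P P'
  id P := { toFun := id, contMDiff := contMDiff_id, comm := fun _ => rfl }
  comp f g :=
    { toFun := g.toFun ∘ f.toFun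
      contMDiff := g.contMDiff.comp f.contMDiff
      comm := fun p => (g.comm _).trans (f.comm p) }

/-- Forget the map to `ℝ`. -/
def SmoothManOverReal.forget : SmoothManOverReal.{u} ⥤ SmoothMan.{u} where
  obj P := P.man
  map f := SmoothManOverReal.Hom.toHom f

/-- The open submanifold `ħ ≠ 0`. -/
def SmoothManOverReal.nonzero (P : SmoothManOverReal.{u}) : TopologicalSpace.Opens P.man :=
  ⟨{p | P.ħ p ≠ 0}, isOpen_ne.preimage P.contMDiff_ħ.continuous⟩

/-- `ℝ_*`, the nonzero real numbers. -/
def RStar : TopologicalSpace.Opens ℝ := ⟨{t | t ≠ 0}, isOpen_ne⟩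

/-! ### Submanifolds, normal spaces, subbundles of the normal bundle -/

/-- `N` is an (embedded) submanifold of `M`: around each of its points there is a smooth chart of
`M` in which `N` is given by a linear subspace of the model space. -/
def IsSubmanifold (M : SmoothMan.{u}) (N : Set M) : Prop :=
  ∀ p ∈ N, ∃ φ ∈ IsManifold.maximalAtlas (𝓡 M.dim) ∞ M.carrier, p ∈ φ.source ∧
    ∃ W : Submodule ℝ (EuclideanSpace ℝ (Fin M.dim)), ∀ q ∈ φ.source, q ∈ N ↔ φ q ∈ W

/-- `v` is the velocity at `p` of a smooth curve of `M` that runs inside `N`. -/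
def IsVelocityIn (M : SmoothMan.{u}) (N : Set M) (p : M) (v : M.Tangent p) : Prop :=
  ∃ γ : ℝ → M, ContMDiffAt 𝓘(ℝ) (𝓡 M.dim) ∞ γ 0 ∧ (∀ᶠ t in nhds 0, γ t ∈ N) ∧
    ∃ h : γ 0 = p, v = h ▸ (mfderiv 𝓘(ℝ) (𝓡 M.dim) γ 0 (1 : ℝ) : M.Tangent (γ 0))

/-- The tangent space `T_p N ⊆ T_p M` of a submanifold, consisting of the velocities of curves in
`N`.  (For a submanifold the velocities already form a linear subspace.) -/
def tangentOf (M : SmoothMan.{u}) (N : Set M) (p : M) : Submodule ℝ (M.Tangent p) :=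
  Submodule.span ℝ {v | IsVelocityIn M N p v}

/-- The fibre `T_p M / T_p N` of the normal bundle `ν_N M`. -/
abbrev Normal (M : SmoothMan.{u}) (N : Set M) (p : M) : Type :=
  M.Tangent p ⧸ tangentOf M N p

/-- The class in the normal space of a tangent vector of `M`. -/
abbrev toNormal (M : SmoothMan.{u}) (N : Set M) (p : M) : M.Tangent p →ₗ[ℝ] Normal M N p :=
  (tangentOf M N p).mkQ

/-- A family of subspaces of the normal spaces along `N` is a (smooth) subbundle of `ν_N M`:
locally it has a frame consisting of classes of smooth vector fields. -/
def IsNormalSubbundle (M : SmoothMan.{u}) (N : Set M)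
    (E : ∀ p : N, Submodule ℝ (Normal M N p.1)) : Prop :=
  ∀ p : N, ∃ U : Set M, IsOpen U ∧ p.1 ∈ U ∧ ∃ (r : ℕ) (s : Fin r → ∀ q : M, M.Tangent q),
    (∀ i, ContMDiffOn (𝓡 M.dim) (𝓡 M.dim).tangent ∞
      (fun q => (⟨q, s i q⟩ : TangentBundle (𝓡 M.dim) M.carrier)) U) ∧
    ∀ q : N, q.1 ∈ U →
      LinearIndependent ℝ (fun i => toNormal M N q.1 (s i q.1)) ∧
      E q = Submodule.span ℝ (Set.range fun i => toNormal M N q.1 (s i q.1))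

/-! ### The category of explosive triples -/

/-- An explosive triple `(M, N, E)`. -/
structure ExplosiveTriple : Type (u + 1) where
  M : SmoothMan.{u}
  N : Set M
  isSubmanifold : IsSubmanifold M N
  E : ∀ p : N, Submodule ℝ (Normal M N p.1)
  isNormalSubbundle : IsNormalSubbundle M N E

/-- A compatible map `φ : (M, N, E) → (M', N', E')`: a smooth map with `φ(N) ⊆ N'` and
`Tφ(E) ⊆ E'`. -/
@[ext]
structure ExplosiveTriple.Hom (X X' : ExplosiveTriple.{u}) extends SmoothMan.Hom X.M X'.M where
  mapsTo : ∀ p ∈ X.N, toFun p ∈ X'.N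
  map_E : ∀ (p : X.N) (v : X.M.Tangent p.1), toNormal X.M X.N p.1 v ∈ X.E p →
    toNormal X'.M X'.N (toFun p.1) (toHom.tangentMap p.1 v) ∈ X'.E ⟨toFun p.1, mapsTo p.1 p.2⟩

theorem SmoothMan.Hom.tangentMap_comp {M M' M'' : SmoothMan.{u}} (f : SmoothMan.Hom M M')
    (g : SmoothMan.Hom M' M'') (p : M) (v : M.Tangent p) :
    mfderiv (𝓡 M.dim) (𝓡 M''.dim) (g.toFun ∘ f.toFun) p v =
      g.tangentMap (f.toFun p) (f.tangentMap p v) := by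
  rw [mfderiv_comp p (g.contMDiff.mdifferentiableAt (by simp))
    (f.contMDiff.mdifferentiableAt (by simp))]
  rfl

instance : Category ExplosiveTriple.{u} where
  Hom X X' := ExplosiveTriple.Hom X X'
  id X :=
    { toFun := id
      contMDiff := contMDiff_id
      mapsTo := fun _ h => h
      map_E := fun p v hv => by
        have h : mfderiv (𝓡 X.M.dim) (𝓡 X.M.dim) (id : X.M → X.M) p.1 v = v := by
          rw [mfderiv_id]; rfl
        change toNormal X.M X.N p.1 (mfderiv (𝓡 X.M.dim) (𝓡 X.M.dim) (id : X.M → X.M) p.1 v) ∈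
          X.E p
        rw [h]
        exact hv }
  comp f g :=
    { toFun := g.toFun ∘ f.toFun
      contMDiff := g.contMDiff.comp f.contMDiff
      mapsTo := fun p h => g.mapsTo _ (f.mapsTo p h)
      map_E := fun p v hv => by
        have h := SmoothMan.Hom.tangentMap_comp f.toHom g.toHom p.1 v
        have h2 := g.map_E ⟨f.toFun p.1, f.mapsTo p.1 p.2⟩ _ (f.map_E p v hv)
        simp only [SmoothMan.Hom.tangentMap] at h h2 ⊢
        rw [h]
        exact h2 }

/-- The forgetful functor `(M, N, E) ↦ M`. -/
def ExplosiveTriple.forget : ExplosiveTriple.{u} ⥤ SmoothMan.{u} where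
  obj X := X.M
  map f := ExplosiveTriple.Hom.toHom f

/-! ### Trivial explosive triples -/

theorem SmoothMan.Hom.tangentMap_mem {M M' : SmoothMan.{u}} (f : SmoothMan.Hom M M')
    {N : Set M} {N' : Set M'} (h : ∀ p ∈ N, f.toFun p ∈ N') (p : M) (v : M.Tangent p)
    (hv : v ∈ tangentOf M N p) : f.tangentMap p v ∈ tangentOf M' N' (f.toFun p) := by
  have key : tangentOf M N p ≤
      (tangentOf M' N' (f.toFun p)).comap (f.tangentMap p).toLinearMap := by
    refine Submodule.span_le.2 ?_
    rintro v ⟨γ, hγ, hN, rfl, rfl⟩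
    refine Submodule.subset_span ⟨f.toFun ∘ γ, f.contMDiff.contMDiffAt.comp 0 hγ,
      hN.mono fun t ht => h _ ht, rfl, ?_⟩
    rw [mfderiv_comp (0 : ℝ) (f.contMDiff.mdifferentiableAt (by simp))
      (hγ.mdifferentiableAt (by simp))]
    rfl
  exact key hv

/-- The trivial explosive triple `(M, M, 0)`. -/
def ExplosiveTriple.trivialObj (M : SmoothMan.{u}) : ExplosiveTriple.{u} where
  M := M
  N := Set.univ
  isSubmanifold := fun p _ => ⟨chartAt _ p, IsManifold.chart_mem_maximalAtlas p,
    mem_chart_source _ p, ⊤, fun _ _ => by simp⟩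
  E := fun _ => ⊥
  isNormalSubbundle := fun _ => ⟨Set.univ, isOpen_univ, trivial, 0, fun i => i.elim0,
    fun i => i.elim0, fun _ _ => ⟨linearIndependent_empty_type, by simp⟩⟩

theorem ExplosiveTriple.trivial_map_E {M M' : SmoothMan.{u}} (φ : SmoothMan.Hom M M') (p : M)
    (v : M.Tangent p)
    (hv : toNormal M Set.univ p v ∈ (⊥ : Submodule ℝ (Normal M Set.univ p))) :
    toNormal M' Set.univ (φ.toFun p) (φ.tangentMap p v) ∈
      (⊥ : Submodule ℝ (Normal M' Set.univ (φ.toFun p))) := by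
  rw [Submodule.mem_bot] at hv ⊢
  exact (Submodule.Quotient.mk_eq_zero _).2
    (φ.tangentMap_mem (N := Set.univ) (N' := Set.univ) (fun _ _ => Set.mem_univ _) p v
      ((Submodule.Quotient.mk_eq_zero _).1 hv))

/-- `(M, M, 0)` as a functor of `M`. -/
def ExplosiveTriple.trivial : SmoothMan.{u} ⥤ ExplosiveTriple.{u} where
  obj M := ExplosiveTriple.trivialObj M
  map {M M'} φ := ExplosiveTriple.Hom.mk (X := trivialObj M) (X' := trivialObj M') φ
    (fun _ _ => True.intro) (fun p v hv => ExplosiveTriple.trivial_map_E φ p.1 v hv)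

/-! ### Explosive charts -/

/-- The map `(x, y, z) ↦ (x, ħ y, ħ² z)` of `ℝⁿ`.  The splitting of the `n` coordinates into
`x`-, `y`- and `z`-coordinates is given by `w`, with values `0`, `1` and `2` respectively. -/
def rescale {n : ℕ} (w : Fin n → Fin 3) (ħ : ℝ) (v : EuclideanSpace ℝ (Fin n)) :
    EuclideanSpace ℝ (Fin n) :=
  WithLp.toLp 2 fun i => ħ ^ (w i : ℕ) * v i

theorem continuous_rescale {n : ℕ} (w : Fin n → Fin 3) :
    Continuous fun a : EuclideanSpace ℝ (Fin n) × ℝ => rescale w a.2 a.1 := by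
  unfold rescale
  fun_prop

/-- The double explosion of an explosive chart on the open set `U ⊆ ℝⁿ`: the open subset
`{(x, y, z, ħ) | (x, ħ y, ħ² z) ∈ U}` of `ℝⁿ × ℝ`. -/
def chartExplosion {n : ℕ} (w : Fin n → Fin 3)
    (U : TopologicalSpace.Opens (EuclideanSpace ℝ (Fin n))) :
    TopologicalSpace.Opens (EuclideanSpace ℝ (Fin n) × ℝ) :=
  ⟨{a | rescale w a.2 a.1 ∈ U}, U.isOpen.preimage (continuous_rescale w)⟩

/-- The structure of an explosive chart on `(M, N, E)`: `M` is (identified through `coord` with) an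
open subset `U` of `ℝⁿ` with coordinates `(x, y, z)` such that `N` is given by `y = z = 0`, and
`E` is spanned by the vectors in the `y` directions. -/
structure ExplosiveChart (X : ExplosiveTriple.{u}) where
  U : TopologicalSpace.Opens (EuclideanSpace ℝ (Fin X.M.dim))
  coord : Diffeomorph (𝓡 X.M.dim) (𝓡 X.M.dim) X.M.carrier U ∞
  w : Fin X.M.dim → Fin 3
  mem_N : ∀ p : X.M, p ∈ X.N ↔ ∀ i, w i ≠ 0 → (coord p : EuclideanSpace ℝ (Fin X.M.dim)) i = 0
  E_eq : ∀ p : X.N, X.E p = Submodule.map (toNormal X.M X.N p.1)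
    (Submodule.comap
      (mfderiv (𝓡 X.M.dim) (𝓡 X.M.dim)
        (fun q : X.M => (coord q : EuclideanSpace ℝ (Fin X.M.dim))) p.1).toLinearMap
      (Submodule.span ℝ {e | ∃ i, w i = 1 ∧ e = EuclideanSpace.single i (1 : ℝ)}))

end

end Explosion

/-! Write `δ_ħ(x, y, z) = (x, ħ y, ħ² z)`. Over an explosive chart the double explosion consists of
the pairs `(v, ħ)` with `δ_ħ v` in the chart, and a map `f` between charts must lift to `(v, ħ) ↦
(δ_ħ⁻¹ (f (δ_ħ v)), ħ)` for `ħ ≠ 0`. Compatibility is what lets this extend smoothly across `ħ = 0`.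
Since `φ(N) ⊆ N'`, the `y'` and `z'` components of `f (δ_ħ v)` vanish at `ħ = 0`; since `Tφ(E) ⊆
E'`, the `z'` components also have vanishing `ħ`-derivative there. Hadamard's lemma, applied once or
twice, then divides by `ħ` or `ħ²` (`exists_contDiff_pow_mul_eq`, `hasLiftAt_of_compatible`).

The set `ħ ≠ 0` is dense, so the extension is unique and lifts compose (`lift_lift`). For identity
maps this is the cocycle condition for gluing charts; in general it is functoriality. Charts adapted
to `(N, E)` exist around every point of `N` by `exists_straightening`.

The gluing uses no quotient: a point of `DoubleExplosion X` is a point `p` of `M` together with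
coordinates in one preferred chart at `p`, and other charts read these coordinates through a lift of
the identity. A chart that is not adapted is admitted only over `ħ ≠ 0` (`IsGood`); this suffices
away from `N`, because every point over `ħ = 0` lies over `N`.

Over `ħ ≠ 0`, or when all weights are `0`, the rescaling is invertible, so `(Pr, ħ)` is a coordinate
system; this gives the clauses on trivial triples and on `ħ ≠ 0`. An explosive chart is one adapted
chart covering everything. -/

namespace Explosion

open Set Filter Topology

noncomputable section

/-! ### Smooth division by powers of a parameter. -/

section Analysis

/-- Differentiation under the integral sign over the unit interval. -/
theorem hasFDerivAt_integral_unitInterval {V G : Type u} [NormedAddCommGroup V] [NormedSpace ℝ V]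
    [FiniteDimensional ℝ V] [NormedAddCommGroup G] [NormedSpace ℝ G] [CompleteSpace G]
    {F : V × ℝ → G} (hF : ContDiff ℝ 1 F) (x : V) :
    HasFDerivAt (fun x => ∫ s in (0 : ℝ)..1, F (x, s))
      (∫ s in (0 : ℝ)..1, (fderiv ℝ F (x, s)).comp (ContinuousLinearMap.inl ℝ V ℝ)) x := by
  have hc : Continuous fun a : V × ℝ =>
      (fderiv ℝ F a).comp (ContinuousLinearMap.inl ℝ V ℝ) :=
    (hF.continuous_fderiv one_ne_zero).clm_comp continuous_const
  obtain ⟨C, hC⟩ := ((isCompact_closedBall x 1).prod (isCompact_Icc (a := (0 : ℝ)) (b := 1))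
    ).exists_bound_of_continuousOn hc.continuousOn
  refine (intervalIntegral.hasFDerivAt_integral_of_dominated_of_fderiv_le
    (F := fun x s => F (x, s)) (bound := fun _ => C)
    (F' := fun x s => (fderiv ℝ F (x, s)).comp (ContinuousLinearMap.inl ℝ V ℝ))
    (Metric.closedBall_mem_nhds x one_pos) ?_ ?_ ?_ ?_ ?_ ?_)
  · exact Eventually.of_forall fun y => (hF.continuous.comp (by fun_prop)).aestronglyMeasurable
  · exact (hF.continuous.comp (by fun_prop)).intervalIntegrable _ _
  · exact (hc.comp (by fun_prop : Continuous fun s : ℝ => (x, s))).aestronglyMeasurable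
  · refine Eventually.of_forall fun s hs y hy => hC (y, s) ⟨hy, ?_⟩
    rw [uIoc_of_le zero_le_one] at hs
    exact Ioc_subset_Icc_self hs
  · exact intervalIntegrable_const
  · refine Eventually.of_forall fun s _ y _ => ?_
    have h1 : HasFDerivAt F (fderiv ℝ F (y, s)) (y, s) :=
      (hF.differentiable one_ne_zero (y, s)).hasFDerivAt
    exact h1.comp y (hasFDerivAt_prodMk_left y s)

/-- The integral over the unit interval of a smooth family of functions is smooth. -/
theorem contDiff_integral_unitInterval {V G : Type u} [NormedAddCommGroup V] [NormedSpace ℝ V]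
    [FiniteDimensional ℝ V] [NormedAddCommGroup G] [NormedSpace ℝ G] [CompleteSpace G]
    {F : V × ℝ → G} (hF : ContDiff ℝ ∞ F) :
    ContDiff ℝ ∞ (fun x => ∫ s in (0 : ℝ)..1, F (x, s)) := by
  rw [contDiff_infty]
  intro n
  -- The derivative is an integral of the same kind with values in `V →L[ℝ] G`, so the target must
  -- vary; the shared universe of `V` and `G` keeps this space in range.
  induction n generalizing G with
  | zero =>
    exact contDiff_zero.2 (continuous_iff_continuousAt.2 fun x =>
      (hasFDerivAt_integral_unitInterval (hF.of_le (by simp)) x).continuousAt)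
  | succ n ih =>
    refine contDiff_succ_iff_hasFDerivAt.2 ⟨_, ?_,
      hasFDerivAt_integral_unitInterval (hF.of_le (by simp))⟩
    exact ih (F := fun a => (fderiv ℝ F a).comp (ContinuousLinearMap.inl ℝ V ℝ))
      ((hF.fderiv_right (by simp)).clm_comp contDiff_const)

/-- Hadamard's lemma. -/
theorem exists_contDiff_eq_add_smul {V G : Type u} [NormedAddCommGroup V] [NormedSpace ℝ V]
    [FiniteDimensional ℝ V] [NormedAddCommGroup G] [NormedSpace ℝ G] [CompleteSpace G]
    {F : V × ℝ → G} (hF : ContDiff ℝ ∞ F) :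
    ∃ Q : V × ℝ → G, ContDiff ℝ ∞ Q ∧ ∀ x t, F (x, t) = F (x, 0) + t • Q (x, t) := by
  -- The quotient is `Q(x, t) = ∫₀¹ ∂ₜF(x, s t) ds`, by the fundamental theorem of calculus along `s
  -- ↦ F(x, s t)`.
  have hd : ContDiff ℝ ∞ (fun a : (V × ℝ) × ℝ => fderiv ℝ F (a.1.1, a.2 * a.1.2) (0, 1)) :=
    ((hF.fderiv_right (m := ∞) (by simp)).comp (by fun_prop)).clm_apply contDiff_const
  refine ⟨_, contDiff_integral_unitInterval hd, fun x t => ?_⟩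
  have hderiv : ∀ s : ℝ, HasDerivAt (fun s : ℝ => F (x, s * t))
      (t • fderiv ℝ F (x, s * t) (0, 1)) s := fun s => by
    have h1 : HasFDerivAt F (fderiv ℝ F (x, s * t)) (x, s * t) :=
      (hF.differentiable (by simp) _).hasFDerivAt
    have h2 : HasDerivAt (fun s : ℝ => (x, s * t)) ((0 : V), t) s :=
      (hasDerivAt_const s x).prodMk (by simpa using (hasDerivAt_id s).mul_const t)
    have h3 := h1.comp_hasDerivAt s h2
    have h4 : ((0 : V), t) = t • ((0 : V), (1 : ℝ)) := by simp
    rw [h4, map_smul] at h3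
    exact h3
  have hcont : Continuous fun s : ℝ => t • fderiv ℝ F (x, s * t) (0, 1) :=
    (hd.continuous.comp (by fun_prop : Continuous fun s : ℝ => ((x, t), s))).const_smul t
  have h := intervalIntegral.integral_eq_sub_of_hasDerivAt (a := 0) (b := 1)
    (fun s _ => hderiv s) (hcont.intervalIntegrable _ _)
  rw [intervalIntegral.integral_smul] at h
  simp only [zero_mul, one_mul] at h
  rw [h]
  abel

/-- A smooth function on an open set agrees near each point with a globally defined one. -/
theorem exists_contDiff_eventuallyEq {V G : Type*} [NormedAddCommGroup V] [NormedSpace ℝ V]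
    [FiniteDimensional ℝ V] [NormedAddCommGroup G] [NormedSpace ℝ G] {f : V → G} {U : Set V}
    (hU : IsOpen U) (hf : ContDiffOn ℝ ∞ f U) {x : V} (hx : x ∈ U) :
    ∃ g : V → G, ContDiff ℝ ∞ g ∧ g =ᶠ[𝓝 x] f := by
  obtain ⟨ε, hε, hball⟩ := Metric.nhds_basis_closedBall.mem_iff.1 (hU.mem_nhds hx)
  let χ : ContDiffBump x := ⟨ε / 2, ε, half_pos hε, half_lt_self hε⟩
  refine ⟨fun y => χ y • f y, contDiff_iff_contDiffAt.2 fun y => ?_, ?_⟩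
  · by_cases hy : y ∈ U
    · exact χ.contDiffAt.smul (hf.contDiffAt (hU.mem_nhds hy))
    · have h0 : (fun y => χ y • f y) =ᶠ[𝓝 y] fun _ => 0 := by
        have hc : IsClosed (Metric.closedBall x ε) := Metric.isClosed_closedBall
        filter_upwards [hc.isOpen_compl.mem_nhds fun h => hy (hball h)] with z hz
        have : χ z = 0 := χ.zero_of_le_dist (le_of_lt (by simpa using hz))
        simp [this]
      exact contDiffAt_const.congr_of_eventuallyEq h0
  · filter_upwards [χ.eventuallyEq_one] with y hy
    simp [hy]

/-- A smooth function of `(x, t)` that vanishes to order `k ≤ 2` along `t = 0` is divisible by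
`t ^ k`. -/
theorem exists_contDiff_pow_mul_eq {V : Type} [NormedAddCommGroup V] [NormedSpace ℝ V]
    [FiniteDimensional ℝ V] {F : V × ℝ → ℝ} {O : Set (V × ℝ)} (hO : IsOpen O)
    (hF : ContDiffOn ℝ ∞ F O) {x : V} (hx : (x, (0 : ℝ)) ∈ O) (k : Fin 3)
    (h1 : k ≠ 0 → ∀ᶠ y in 𝓝 x, F (y, 0) = 0)
    (h2 : k = 2 → ∀ᶠ y in 𝓝 x, HasDerivAt (fun t => F (y, t)) 0 0) :
    ∃ H : V × ℝ → ℝ, ContDiff ℝ ∞ H ∧ ∀ᶠ b in 𝓝 (x, (0 : ℝ)), b.2 ^ (k : ℕ) * H b = F b := by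
  -- Hadamard's lemma needs the whole segment down to `t = 0`; a globally defined `g` with the germ
  -- of `F` removes all domain questions.
  obtain ⟨g, hg, hgF⟩ := exists_contDiff_eventuallyEq hO hF hx
  have hfst : Tendsto Prod.fst (𝓝 (x, (0 : ℝ))) (𝓝 x) := continuousAt_fst
  have hin : Tendsto (fun y : V => (y, (0 : ℝ))) (𝓝 x) (𝓝 (x, 0)) :=
    (by fun_prop : Continuous fun y : V => (y, (0 : ℝ))).continuousAt
  by_cases hk0 : k = 0
  · subst hk0
    exact ⟨g, hg, by filter_upwards [hgF] with b hb; simpa using hb⟩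
  obtain ⟨Q, hQ, hgQ⟩ := exists_contDiff_eq_add_smul hg
  have hg0 : ∀ᶠ y in 𝓝 x, g (y, 0) = 0 := by
    filter_upwards [h1 hk0, hin.eventually hgF] with y h h'
    rw [h', h]
  by_cases hk2 : k = 2
  · subst hk2
    obtain ⟨R, hR, hQR⟩ := exists_contDiff_eq_add_smul hQ
    -- From `g(y, t) = g(y, 0) + t Q(y, t)` the product rule identifies `Q(y, 0)` with the
    -- `t`-derivative of `g` at `0`, which vanishes; hence `Q` can be divided by `t` once more.
    have hQ0 : ∀ᶠ y in 𝓝 x, Q (y, 0) = 0 := by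
      filter_upwards [h2 rfl, hin.eventually hgF.eventually_nhds] with y h h'
      have hcy : Tendsto (fun t : ℝ => (y, t)) (𝓝 0) (𝓝 (y, 0)) :=
        (by fun_prop : Continuous fun t : ℝ => (y, t)).continuousAt
      have hg' : HasDerivAt (fun t => g (y, t)) 0 0 :=
        h.congr_of_eventuallyEq (hcy.eventually h')
      have hQd : HasDerivAt (fun t => Q (y, t)) (deriv (fun t => Q (y, t)) 0) 0 :=
        ((hQ.differentiable (by simp)).comp
          (by fun_prop : Differentiable ℝ fun t : ℝ => (y, t)) 0).hasDerivAt
      have hg'' := ((hasDerivAt_id (0 : ℝ)).mul hQd).const_add (g (y, 0))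
      have : (fun t => g (y, t)) = fun t => g (y, 0) + ((id : ℝ → ℝ) * (fun t => Q (y, t) : ℝ → ℝ)) t := by
        funext t; simpa using hgQ y t
      rw [this] at hg'
      simpa using (hg'.unique hg'').symm
    refine ⟨R, hR, ?_⟩
    filter_upwards [hgF, hfst.eventually hg0, hfst.eventually hQ0] with b hb hb0 hbQ
    rw [← hb, ← Prod.mk.eta (p := b), hgQ, hQR, hb0, hbQ]
    simp [pow_two, mul_assoc]
  · have hk1 : k = 1 := by omega
    subst hk1
    refine ⟨Q, hQ, ?_⟩
    filter_upwards [hgF, hfst.eventually hg0] with b hb hb0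
    rw [← hb, ← Prod.mk.eta (p := b), hgQ, hb0]
    simp

end Analysis

/-! ### The rescaling `δ_ħ` and lifts of maps between open sets of `ℝⁿ`. -/

section Rescale

variable {n m : ℕ}

/-- The model `ℝⁿ` of `n`-dimensional manifolds. -/
abbrev Euc (n : ℕ) : Type := EuclideanSpace ℝ (Fin n)

@[simp]
theorem rescale_apply (w : Fin n → Fin 3) (t : ℝ) (v : Euc n) (i : Fin n) :
    rescale w t v i = t ^ (w i : ℕ) * v i := rfl

theorem contDiff_rescale (w : Fin n → Fin 3) :
    ContDiff ℝ ∞ fun a : Euc n × ℝ => rescale w a.2 a.1 := by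
  refine contDiff_euclidean.2 fun i => ?_
  simp only [rescale_apply]
  fun_prop

theorem rescale_inv_rescale (w : Fin n → Fin 3) {t : ℝ} (ht : t ≠ 0) (v : Euc n) :
    rescale w t⁻¹ (rescale w t v) = v := by
  ext i
  simp [ht]

theorem rescale_rescale_inv (w : Fin n → Fin 3) {t : ℝ} (ht : t ≠ 0) (v : Euc n) :
    rescale w t (rescale w t⁻¹ v) = v := by
  ext i
  simp [ht]

theorem rescale_of_eq_zero {w : Fin n → Fin 3} (hw : w = 0) (t : ℝ) (v : Euc n) :
    rescale w t v = v := by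
  ext i
  simp [hw]

theorem rescale_zero_apply {w : Fin n → Fin 3} {i : Fin n} (hi : w i ≠ 0) (v : Euc n) :
    rescale w 0 v i = 0 := by
  have : (w i : ℕ) ≠ 0 := fun h => hi (Fin.ext h)
  simp [this]

theorem hasDerivAt_rescale_zero (w : Fin n → Fin 3) (v : Euc n) :
    HasDerivAt (fun t => rescale w t v) (WithLp.toLp 2 fun i => if w i = 1 then v i else 0) 0 := by
  have h : HasDerivAt (fun t : ℝ => fun i => t ^ (w i : ℕ) * v i)
      (fun i => if w i = 1 then v i else 0) 0 := by
    refine hasDerivAt_pi.2 fun i => ?_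
    have := (hasDerivAt_pow (w i : ℕ) (0 : ℝ)).mul_const (v i)
    refine this.congr_deriv ?_
    generalize w i = k
    fin_cases k <;> simp
  exact (PiLp.continuousLinearEquiv 2 ℝ fun _ : Fin n => ℝ).symm.hasFDerivAt.comp_hasDerivAt 0 h

theorem dense_ne_zero : Dense {b : Euc n × ℝ | b.2 ≠ 0} := by
  have h : Dense {t : ℝ | t ≠ 0} := dense_compl_singleton 0
  exact h.preimage isOpenMap_snd

instance neBot_nhdsWithin_ne_zero (a : Euc n × ℝ) : NeBot (𝓝[{b | b.2 ≠ 0}] a) :=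
  mem_closure_iff_nhdsWithin_neBot.1 (dense_ne_zero a)

/-- Continuous maps that agree over `ħ ≠ 0` after rescaling agree everywhere. -/
theorem eq_of_rescale_eventuallyEq {w : Fin m → Fin 3} {a : Euc n × ℝ} {G H : Euc n × ℝ → Euc m}
    (hG : ContinuousAt G a) (hH : ContinuousAt H a)
    (h : ∀ᶠ b in 𝓝 a, b.2 ≠ 0 → rescale w b.2 (G b) = rescale w b.2 (H b)) : G a = H a := by
  refine tendsto_nhds_unique_of_eventuallyEq (l := 𝓝[{b | b.2 ≠ 0}] a)
    (hG.mono_left nhdsWithin_le_nhds) (hH.mono_left nhdsWithin_le_nhds) ?_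
  filter_upwards [nhdsWithin_le_nhds h, self_mem_nhdsWithin] with b hb hb0
  rw [← rescale_inv_rescale w hb0 (G b), hb hb0, rescale_inv_rescale w hb0]

/-- The lift of `f : ℝⁿ → ℝᵐ` to the double explosions: the map
`(v, ħ) ↦ (δ_ħ)⁻¹ (f (δ_ħ v))`, extended by continuity to `ħ = 0`. -/
def liftFun (w : Fin n → Fin 3) (w' : Fin m → Fin 3) (f : Euc n → Euc m) :
    Euc n × ℝ → Euc m :=
  extendFrom {b | b.2 ≠ 0} fun b => rescale w' b.2⁻¹ (f (rescale w b.2 b.1))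

/-- `f` has a smooth lift to the double explosions near `a`. -/
def HasLiftAt (w : Fin n → Fin 3) (w' : Fin m → Fin 3) (f : Euc n → Euc m) (a : Euc n × ℝ) :
    Prop :=
  ∃ H : Euc n × ℝ → Euc m, (∀ᶠ b in 𝓝 a, ContDiffAt ℝ ∞ H b) ∧
    ∀ᶠ b in 𝓝 a, rescale w' b.2 (H b) = f (rescale w b.2 b.1)

variable {w : Fin n → Fin 3} {w' : Fin m → Fin 3} {f : Euc n → Euc m} {a : Euc n × ℝ}

/-- Over `ħ ≠ 0` the equation forces `H` to be the function that `extendFrom` extends, so continuity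
of `H` at `a` supplies the limit. Thus `liftFun` does not depend on a choice of lift. -/
theorem liftFun_eq {H : Euc n × ℝ → Euc m} (hH : ContinuousAt H a)
    (h : ∀ᶠ b in 𝓝 a, rescale w' b.2 (H b) = f (rescale w b.2 b.1)) :
    liftFun w w' f a = H a := by
  refine extendFrom_eq (dense_ne_zero a) ((hH.mono_left nhdsWithin_le_nhds).congr' ?_)
  filter_upwards [nhdsWithin_le_nhds h, self_mem_nhdsWithin] with b hb hb0
  rw [← hb, rescale_inv_rescale w' hb0]

/-- A local lift is continuous at all nearby points, so `liftFun_eq` applies at each of them and the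
canonical lift inherits smoothness and the defining equation. -/
theorem HasLiftAt.eventually (h : HasLiftAt w w' f a) :
    ∀ᶠ b in 𝓝 a, ContDiffAt ℝ ∞ (liftFun w w' f) b ∧
      rescale w' b.2 (liftFun w w' f b) = f (rescale w b.2 b.1) := by
  obtain ⟨H, hH, hHf⟩ := h
  have he : ∀ᶠ b in 𝓝 a, liftFun w w' f b = H b := by
    filter_upwards [hH, hHf.eventually_nhds] with b hb hb'
    exact liftFun_eq hb.continuousAt hb'
  filter_upwards [hH, hHf, he, he.eventually_nhds] with b h1 h2 h3 h4
  exact ⟨h1.congr_of_eventuallyEq h4, by rw [h3, h2]⟩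

theorem hasLiftAt_of_ne_zero {U : Set (Euc n)} (hU : IsOpen U) (hf : ContDiffOn ℝ ∞ f U)
    (ha : rescale w a.2 a.1 ∈ U) (h0 : a.2 ≠ 0) : HasLiftAt w w' f a := by
  refine ⟨fun b => rescale w' b.2⁻¹ (f (rescale w b.2 b.1)), ?_, ?_⟩
  · filter_upwards [(hU.preimage (continuous_rescale w)).mem_nhds ha,
      (isOpen_ne.preimage continuous_snd).mem_nhds h0] with b hb hb0
    have h1 : ContDiffAt ℝ ∞ (fun b : Euc n × ℝ => f (rescale w b.2 b.1)) b :=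
      (hf.contDiffAt (hU.mem_nhds hb)).comp b (contDiff_rescale w).contDiffAt
    exact (contDiff_rescale w').contDiffAt.comp b (h1.prodMk (contDiffAt_snd.inv hb0))
  · filter_upwards [(isOpen_ne.preimage continuous_snd).mem_nhds h0] with b hb0
    exact rescale_rescale_inv w' hb0 _

/-- The compatibility conditions on `f` under which it has a lift across `ħ = 0`. -/
theorem hasLiftAt_of_compatible {U : Set (Euc n)} (hU : IsOpen U) (hf : ContDiffOn ℝ ∞ f U)
    (hz : ∀ u ∈ U, (∀ j, w j ≠ 0 → u j = 0) → ∀ i, w' i ≠ 0 → f u i = 0)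
    (hd : ∀ u ∈ U, (∀ j, w j ≠ 0 → u j = 0) → ∀ h : Euc n, (∀ j, w j = 2 → h j = 0) →
      ∀ i, w' i = 2 → fderiv ℝ f u h i = 0)
    (ha : rescale w a.2 a.1 ∈ U) : HasLiftAt w w' f a := by
  by_cases h0 : a.2 ≠ 0
  · exact hasLiftAt_of_ne_zero hU hf ha h0
  obtain ⟨x, t⟩ := a
  obtain rfl : t = 0 := by simpa using h0
  have hO : IsOpen {b : Euc n × ℝ | rescale w b.2 b.1 ∈ U} := hU.preimage (continuous_rescale w)
  have hF : ContDiffOn ℝ ∞ (fun b : Euc n × ℝ => f (rescale w b.2 b.1))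
      {b | rescale w b.2 b.1 ∈ U} :=
    hf.comp (contDiff_rescale w).contDiffOn fun _ h => h
  have hev : ∀ᶠ y in 𝓝 x, rescale w 0 y ∈ U :=
    (by fun_prop : Continuous fun y : Euc n => (y, (0 : ℝ))).continuousAt.eventually
      (hO.mem_nhds ha)
  have key : ∀ i, ∃ H : Euc n × ℝ → ℝ, ContDiff ℝ ∞ H ∧ ∀ᶠ b in 𝓝 (x, (0 : ℝ)),
      b.2 ^ (w' i : ℕ) * H b = f (rescale w b.2 b.1) i := fun i => by
    refine exists_contDiff_pow_mul_eq hO (contDiffOn_euclidean.1 hF i) ha (w' i) (fun hi => ?_)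
      fun hi => ?_
    · filter_upwards [hev] with y hy
      exact hz _ hy (fun j hj => rescale_zero_apply hj y) i hi
    · filter_upwards [hev] with y hy
      have h1 : HasFDerivAt f (fderiv ℝ f (rescale w 0 y)) (rescale w 0 y) :=
        ((hf.contDiffAt (hU.mem_nhds hy)).differentiableAt (by simp)).hasFDerivAt
      -- The velocity of `t ↦ δ_t y` at `0` is the weight-one part of `y`. Its image under the
      -- derivative of `f` has no components of weight `2`, by `hd`.
      have h2 := h1.comp_hasDerivAt 0 (hasDerivAt_rescale_zero w y)
      have h3 := (EuclideanSpace.proj (𝕜 := ℝ) i).hasFDerivAt.comp_hasDerivAt 0 h2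
      have h4 := hd _ hy (fun j hj => rescale_zero_apply hj y)
        (WithLp.toLp 2 fun i => if w i = 1 then y i else 0) (fun j hj => by simp [hj]) i hi
      exact h3.congr_deriv h4
  choose H hH hHf using key
  refine ⟨fun b => WithLp.toLp 2 fun i => H i b, Eventually.of_forall fun b => ?_, ?_⟩
  · exact (contDiff_euclidean.2 hH).contDiffAt
  · filter_upwards [eventually_all.2 hHf] with b hb
    ext i
    exact hb i

end Rescale

/-! ### Coordinates adapted to a linear subspace and a frame of normal vectors. -/

section Straightening

/-- The smooth inverse function theorem on an open set. -/
theorem exists_openPartialHomeomorph_of_isInvertible {n : ℕ} {f : Euc n → Euc n} {O : Set (Euc n)}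
    (hO : IsOpen O) (hf : ContDiffOn ℝ ∞ f O) {x : Euc n} (hx : x ∈ O)
    (hfx : (fderiv ℝ f x).IsInvertible) :
    ∃ ψ : OpenPartialHomeomorph (Euc n) (Euc n), x ∈ ψ.source ∧ ψ.source ⊆ O ∧ ⇑ψ = f ∧
      ContDiffOn ℝ ∞ ψ.symm ψ.target := by
  have hd : ContinuousOn (fderiv ℝ f) O := hf.continuousOn_fderiv_of_isOpen hO (by simp)
  -- Restricting to the open set where the derivative is invertible makes the local inverse smooth
  -- on its whole target, not only at the image of `x`.
  have hO' : IsOpen (O ∩ fderiv ℝ f ⁻¹' range ((↑) : (Euc n ≃L[ℝ] Euc n) → Euc n →L[ℝ] Euc n)) :=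
    hd.isOpen_inter_preimage hO ContinuousLinearEquiv.isOpen
  obtain ⟨e, he⟩ := hfx
  have hfx : ContDiffAt ℝ ∞ f x := hf.contDiffAt (hO.mem_nhds hx)
  have hfe : HasFDerivAt f (e : Euc n →L[ℝ] Euc n) x := by
    rw [he]
    exact (hfx.differentiableAt (by simp)).hasFDerivAt
  refine ⟨(hfx.toOpenPartialHomeomorph f hfe (by simp)).restrOpen _ hO',
    ⟨hfx.mem_toOpenPartialHomeomorph_source hfe _, hx, e, he⟩, fun y hy => hy.2.1, rfl, ?_⟩
  intro y hy
  obtain ⟨hyO, e', he'⟩ := ((OpenPartialHomeomorph.map_target _ hy).2 :)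
  have h1 := hf.contDiffAt (hO.mem_nhds hyO)
  refine (OpenPartialHomeomorph.contDiffAt_symm _ (f₀' := e') hy ?_ h1).contDiffWithinAt
  rw [he']
  exact (h1.differentiableAt (by simp)).hasFDerivAt

variable {n r : ℕ}

theorem basis_sumExtend_inl {ι k V : Type*} [DivisionRing k] [AddCommGroup V] [Module k V]
    {v : ι → V} (hv : LinearIndependent k v) (i : ι) :
    Module.Basis.sumExtend hv (Sum.inl i) = v i := by
  rw [Module.Basis.sumExtend, Module.Basis.reindex_apply, Module.Basis.extend_apply_self]
  let _ := Classical.decPred (· ∈ range v)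
  exact congrArg Subtype.val (Equiv.Set.sumDiffSubset_apply_inl
    (hv.linearIndepOn_id.subset_extend (subset_univ _)) (Equiv.ofInjective v hv.injective i))

/-- Coordinates straightening a linear subspace together with a frame of a complement of it that is
defined on a neighbourhood of one of its points: new coordinates of weight `0` are coordinates on
the subspace, those of weight `1` are dual to the frame. -/
theorem exists_straightening (W : Submodule ℝ (Euc n)) {O : Set (Euc n)} (hO : IsOpen O)
    (S : Fin r → Euc n → Euc n) (hS : ∀ i, ContDiffOn ℝ ∞ (S i) O) {x : Euc n} (hx : x ∈ O)
    (hxW : x ∈ W) (hind : LinearIndependent ℝ fun i => W.mkQ (S i x)) :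
    ∃ (ψ : OpenPartialHomeomorph (Euc n) (Euc n)) (w : Fin n → Fin 3), x ∈ ψ.source ∧
      ψ.source ⊆ O ∧ ContDiffOn ℝ ∞ ψ ψ.source ∧ ContDiffOn ℝ ∞ ψ.symm ψ.target ∧
      (∀ u ∈ ψ.source, u ∈ W ↔ ∀ i, w i ≠ 0 → ψ u i = 0) ∧
      ∀ u ∈ ψ.source, u ∈ W → ∀ h : Euc n,
        W.mkQ h ∈ Submodule.span ℝ (range fun i => W.mkQ (S i u)) ↔
          ∀ i, w i = 2 → fderiv ℝ ψ u h i = 0 := by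
  let bW := Module.finBasis ℝ W
  set d := Module.finrank ℝ W
  have hli : LinearIndependent ℝ (Sum.elim (fun j : Fin d => (bW j : Euc n)) fun i => S i x) :=
    bW.linearIndependent.sumElim_of_quotient _ hind
  let b := Module.Basis.sumExtend hli
  let K := Module.Basis.sumExtendIndex hli
  have hb : ∀ k, b (Sum.inl k) = Sum.elim (fun j : Fin d => (bW j : Euc n)) (fun i => S i x) k :=
    fun k => basis_sumExtend_inl hli k
  have : Finite ((Fin d ⊕ Fin r) ⊕ K) := Module.Finite.finite_basis b
  have : Finite K := Finite.sum_right (Fin d ⊕ Fin r)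
  have : Fintype K := Fintype.ofFinite K
  have hcard : Fintype.card ((Fin d ⊕ Fin r) ⊕ K) = Fintype.card (Fin n) := by
    rw [← Module.finrank_eq_card_basis b, finrank_euclideanSpace]
  let e : ((Fin d ⊕ Fin r) ⊕ K) ≃ Fin n := Fintype.equivOfCardEq hcard
  -- Weight `0` belongs to the basis of `W`, weight `1` to the frame `S`, weight `2` to the vectors
  -- completing these to a basis at `x`.
  let w : Fin n → Fin 3 := fun i =>
    Sum.elim (Sum.elim (fun _ => 0) fun _ => 1) (fun _ => 2) (e.symm i)
  let col : (Fin d ⊕ Fin r) ⊕ K → Euc n → Euc n := fun k u =>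
    Sum.elim (Sum.elim (fun j => (bW j : Euc n)) fun i => S i u) (fun k => b (Sum.inr k)) k
  have hcol : ∀ k, ContDiffOn ℝ ∞ (col k) O := by
    rintro ((j | i) | k)
    · exact contDiffOn_const
    · exact hS i
    · exact contDiffOn_const
  -- `A u` has the columns `col · u`. Only the columns from `S` depend on `u`; those spanning `W`
  -- are constant, which is essential for `hderiv` below.
  let A : Euc n → Euc n →L[ℝ] Euc n := fun u =>
    ∑ k, (EuclideanSpace.proj (𝕜 := ℝ) (e k)).smulRight (col k u)
  have hA : ∀ u h, A u h = ∑ k, h (e k) • col k u := fun u h => by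
    simp [A]
  have hAs : ContDiffOn ℝ ∞ A O :=
    ContDiffOn.sum fun k _ => contDiffOn_const.smulRight (hcol k)
  -- the linear maps `A u` are invertible near `x`
  have hAx : (A x).IsInvertible := by
    have hinj : Function.Injective (A x).toLinearMap := by
      refine (injective_iff_map_eq_zero _).2 fun h hh => ?_
      have h1 : ∑ k, h (e k) • b k = 0 := by
        rw [← hh]
        refine Eq.trans (Finset.sum_congr rfl fun k _ => ?_) (hA x h).symm
        rcases k with k | k
        · rw [hb]; rcases k with j | i <;> rfl
        · rfl
      ext i
      simpa using Fintype.linearIndependent_iff.1 b.linearIndependent _ h1 (e.symm i)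
    exact ⟨(LinearEquiv.ofInjectiveEndo _ hinj).toContinuousLinearEquiv, by ext1; rfl⟩
  let O₁ := O ∩ A ⁻¹' range ((↑) : (Euc n ≃L[ℝ] Euc n) → Euc n →L[ℝ] Euc n)
  have hO₁ : IsOpen O₁ := hAs.continuousOn.isOpen_inter_preimage hO ContinuousLinearEquiv.isOpen
  have hAinv : ∀ u ∈ O₁, (A u).IsInvertible := fun u hu => hu.2
  let B : Euc n → Euc n →L[ℝ] Euc n := fun u => (A u).inverse
  have hBs : ContDiffOn ℝ ∞ B O₁ := fun u hu =>
    ((hAinv u hu).contDiffAt_map_inverse.comp u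
      (hAs.contDiffAt (hO.mem_nhds hu.1))).contDiffWithinAt
  have hAB : ∀ u ∈ O₁, ∀ y, A u (B u y) = y := fun u hu y =>
    ((hAinv u hu).inverse_apply_eq.1 rfl).symm
  have hAinj : ∀ u ∈ O₁, Function.Injective (A u) := fun u hu => (hAinv u hu).injective
  -- coordinates on `W`
  let coordW : W → Euc n := fun y =>
    WithLp.toLp 2 fun i => Sum.elim (Sum.elim (fun j => bW.repr y j) fun _ => 0) (fun _ => 0)
      (e.symm i)
  have hcoordW : ∀ u y, A u (coordW y) = y := fun u y => by
    rw [hA, Fintype.sum_sum_type, Fintype.sum_sum_type]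
    simp only [coordW, col, Equiv.symm_apply_apply, Sum.elim_inl, Sum.elim_inr, zero_smul,
      Finset.sum_const_zero, add_zero]
    have h := congrArg Subtype.val (bW.sum_repr y)
    rwa [Submodule.coe_sum] at h
  have hW : ∀ u ∈ O₁, ∀ h, A u h ∈ W ↔ ∀ i, w i ≠ 0 → h i = 0 := fun u hu h => by
    refine ⟨fun hh i hi => ?_, fun hh => ?_⟩
    · have : h = coordW ⟨A u h, hh⟩ := hAinj u hu (hcoordW u ⟨A u h, hh⟩).symm
      rw [this]
      simp only [coordW]
      revert hi
      simp only [w]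
      rcases e.symm i with (j | i) | k <;> simp
    · rw [hA, Fintype.sum_sum_type, Fintype.sum_sum_type]
      have h1 : ∀ i, h (e (Sum.inl (Sum.inr i))) = 0 := fun i => hh _ (by simp [w])
      have h2 : ∀ k, h (e (Sum.inr k)) = 0 := fun k => hh _ (by simp [w])
      simp only [h1, h2, zero_smul, Finset.sum_const_zero, add_zero]
      exact W.sum_mem fun j _ => W.smul_mem _ (bW j).2
  have hSpan : ∀ u ∈ O₁, ∀ h, W.mkQ (A u h) ∈ Submodule.span ℝ (range fun i => W.mkQ (S i u)) ↔
      ∀ i, w i = 2 → h i = 0 := fun u hu h => by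
    refine ⟨fun hh i hi => ?_, fun hh => ?_⟩
    · obtain ⟨c, hc⟩ := (Submodule.mem_span_range_iff_exists_fun ℝ).1 hh
      let h' : Euc n := WithLp.toLp 2 fun i =>
        Sum.elim (Sum.elim (fun _ => 0) fun i => c i) (fun _ => 0) (e.symm i)
      have hh' : A u h' = ∑ i, c i • S i u := by
        rw [hA, Fintype.sum_sum_type, Fintype.sum_sum_type]
        simp [h', col]
      have h1 : A u (h - h') ∈ W := by
        rw [← W.ker_mkQ, LinearMap.mem_ker, map_sub, map_sub, sub_eq_zero, hh', ← hc]
        simp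
      have h2 := (hW u hu _).1 h1 i (by simp [hi])
      have h3 : h' i = 0 := by
        simp only [h']
        revert hi
        simp only [w]
        rcases e.symm i with (j | i) | k <;> simp
      rw [← h2]
      simp [h3]
    · rw [hA, Fintype.sum_sum_type, Fintype.sum_sum_type]
      have h2 : ∀ k, h (e (Sum.inr k)) = 0 := fun k => hh _ (by simp [w])
      simp only [h2, zero_smul, Finset.sum_const_zero, add_zero, map_add]
      have h3 : W.mkQ (∑ j, h (e (Sum.inl (Sum.inl j))) • col (Sum.inl (Sum.inl j)) u) = 0 := by
        rw [← LinearMap.mem_ker, W.ker_mkQ]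
        exact W.sum_mem fun j _ => W.smul_mem _ (bW j).2
      rw [h3, zero_add, map_sum]
      refine Submodule.sum_mem _ fun i _ => ?_
      rw [map_smul]
      exact Submodule.smul_mem _ _ (Submodule.subset_span ⟨i, rfl⟩)
  -- the new coordinates
  have hχ : ContDiffOn ℝ ∞ (fun u => B u u) O₁ := hBs.clm_apply contDiffOn_id
  -- For `u ∈ W` the vector `B u' u` is independent of `u'`, since the columns spanning `W` are
  -- constant. Hence near `u` the new coordinate map is `B u' (u' - u)` plus a constant, and the
  -- term with the derivative of `B` is multiplied by `u - u = 0`.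
  have hderiv : ∀ u ∈ O₁, u ∈ W → fderiv ℝ (fun u => B u u) u = B u := fun u hu huW => by
    have h1 : (fun u' => B u' u') =ᶠ[𝓝 u] fun u' => B u' (u' - u) + coordW ⟨u, huW⟩ := by
      filter_upwards [hO₁.mem_nhds hu] with u' hu'
      have : B u' u = coordW ⟨u, huW⟩ := hAinj u' hu' (by rw [hAB u' hu', hcoordW])
      rw [map_sub, this, sub_add_cancel]
    have h2 : HasFDerivAt B (fderiv ℝ B u) u :=
      ((hBs.contDiffAt (hO₁.mem_nhds hu)).differentiableAt (by simp)).hasFDerivAt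
    have h3 := (h2.clm_apply ((hasFDerivAt_id u).sub_const u)).add_const (coordW ⟨u, huW⟩)
    rw [h1.fderiv_eq]
    refine h3.fderiv.trans ?_
    ext1 h
    simp
  have hx₁ : x ∈ O₁ := ⟨hx, hAx⟩
  obtain ⟨ψ, hxψ, hψO, hψ, hψs⟩ := exists_openPartialHomeomorph_of_isInvertible hO₁ hχ hx₁ (by
    rw [hderiv x hx₁ hxW]
    obtain ⟨E, hE⟩ := hAx
    refine ⟨E.symm, ?_⟩
    simp only [B]
    rw [← hE, ContinuousLinearMap.inverse_equiv])
  refine ⟨ψ, w, hxψ, fun u hu => (hψO hu).1, hψ ▸ hχ.mono hψO, hψs, fun u hu => ?_,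
    fun u hu huW h => ?_⟩
  · rw [hψ, ← hW u (hψO hu), hAB u (hψO hu)]
  · rw [hψ, hderiv u (hψO hu) huW, ← hSpan u (hψO hu), hAB u (hψO hu)]

end Straightening

/-! ### Tangent and normal spaces of a submanifold, read in charts. -/

section Tangent

variable {M : SmoothMan.{u}} {N : Set M} {c : OpenPartialHomeomorph M.carrier (Euc M.dim)}

theorem mdifferentiable_of_mem_maximalAtlas
    (hc : c ∈ IsManifold.maximalAtlas (𝓡 M.dim) ∞ M.carrier) :
    c.MDifferentiable (𝓡 M.dim) (𝓡 M.dim) :=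
  ⟨(contMDiffOn_of_mem_maximalAtlas hc).mdifferentiableOn (by simp),
    (contMDiffOn_symm_of_mem_maximalAtlas hc).mdifferentiableOn (by simp)⟩

/-- The derivative of a chart. -/
def chartDeriv (c : OpenPartialHomeomorph M.carrier (Euc M.dim)) (p : M) :
    M.Tangent p →L[ℝ] Euc M.dim :=
  mfderiv (𝓡 M.dim) (𝓡 M.dim) c p

/-- The derivative of a smooth chart as an equivalence. -/
def chartDerivEquiv (hc : c ∈ IsManifold.maximalAtlas (𝓡 M.dim) ∞ M.carrier) {p : M}
    (hp : p ∈ c.source) : M.Tangent p ≃L[ℝ] Euc M.dim :=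
  (mdifferentiable_of_mem_maximalAtlas hc).mfderiv hp

theorem chartDerivEquiv_apply (hc : c ∈ IsManifold.maximalAtlas (𝓡 M.dim) ∞ M.carrier) {p : M}
    (hp : p ∈ c.source) (v : M.Tangent p) : chartDerivEquiv hc hp v = chartDeriv c p v := rfl

/-- This removes the transport along `γ 0 = p`: all tangent spaces are definitionally the model
space, so velocities can be compared there. -/
theorem isVelocityIn_of_eq {γ : ℝ → M} {p : M} {v : M.Tangent p}
    (hγ : ContMDiffAt 𝓘(ℝ) (𝓡 M.dim) ∞ γ 0) (hN : ∀ᶠ t in 𝓝 0, γ t ∈ N) (h : γ 0 = p)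
    (hv : (v : Euc M.dim) = (mfderiv 𝓘(ℝ) (𝓡 M.dim) γ 0 (1 : ℝ) : Euc M.dim)) :
    IsVelocityIn M N p v := by
  subst h
  exact ⟨γ, hγ, hN, rfl, hv⟩

/-- In a chart in which `N` is a linear subspace `W`, so is its tangent space. -/
theorem mem_tangentOf_iff (hc : c ∈ IsManifold.maximalAtlas (𝓡 M.dim) ∞ M.carrier)
    {W : Submodule ℝ (Euc M.dim)} (hW : ∀ q ∈ c.source, q ∈ N ↔ c q ∈ W) {p : M}
    (hp : p ∈ c.source) (hpN : p ∈ N) (v : M.Tangent p) :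
    v ∈ tangentOf M N p ↔ chartDeriv c p v ∈ W := by
  have hmd := mdifferentiable_of_mem_maximalAtlas hc
  constructor
  · intro hv
    have key : tangentOf M N p ≤ Submodule.comap (chartDeriv c p).toLinearMap W := by
      refine Submodule.span_le.2 ?_
      rintro v ⟨γ, hγ, hN, rfl, rfl⟩
      have hd : MDifferentiableAt 𝓘(ℝ) (𝓡 M.dim) γ 0 := hγ.mdifferentiableAt (by simp)
      have hcomp : chartDeriv c (γ 0) (mfderiv 𝓘(ℝ) (𝓡 M.dim) γ 0 (1 : ℝ)) =
          fderiv ℝ (c ∘ γ) 0 1 := by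
        rw [← mfderiv_eq_fderiv, mfderiv_comp (0 : ℝ) (hmd.mdifferentiableAt hp) hd]
        rfl
      change chartDeriv c (γ 0) (mfderiv 𝓘(ℝ) (𝓡 M.dim) γ 0 (1 : ℝ)) ∈ W
      -- It suffices to pair with each `y` in the orthogonal complement of `W`: the function `⟪y, c
      -- (γ t)⟫` is zero near `t = 0`, hence so is its derivative.
      rw [hcomp, ← W.orthogonal_orthogonal, Submodule.mem_orthogonal]
      intro y hy
      have hd : DifferentiableAt ℝ (c ∘ γ) 0 :=
        ((hmd.mdifferentiableAt hp).comp (0 : ℝ) hd).differentiableAt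
      have h1 := (innerSL ℝ y).hasFDerivAt.comp (0 : ℝ) hd.hasFDerivAt
      have h2 : (innerSL ℝ y ∘ (c ∘ γ)) =ᶠ[𝓝 0] fun _ => (0 : ℝ) := by
        filter_upwards [hN, hγ.continuousAt.eventually (c.open_source.mem_nhds hp)] with t ht hts
        exact W.inner_left_of_mem_orthogonal ((hW _ hts).1 ht) hy
      have h3 := h1.unique ((hasFDerivAt_const (0 : ℝ) (0 : ℝ)).congr_of_eventuallyEq h2)
      exact congrArg (fun L : ℝ →L[ℝ] ℝ => L 1) h3
    exact key hv
  · intro hv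
    refine Submodule.subset_span ?_
    set h : Euc M.dim := chartDeriv c p v with hh
    -- The straight line in the chart through `c p` with velocity `h` stays in `W`, so its preimage
    -- is a curve in `N` with velocity `v`.
    let ℓ : ℝ → Euc M.dim := fun t => c p + t • h
    have hℓ : ContDiff ℝ ∞ ℓ := by fun_prop
    have hℓ0 : ℓ 0 = c p := by simp [ℓ]
    have hmem : ℓ 0 ∈ c.target := hℓ0 ▸ c.map_source hp
    have hsymm : ContMDiffAt (𝓡 M.dim) (𝓡 M.dim) ∞ c.symm (ℓ 0) :=
      contMDiffAt_symm_of_mem_maximalAtlas hc hmem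
    refine isVelocityIn_of_eq (γ := c.symm ∘ ℓ) (hsymm.comp 0 hℓ.contMDiff.contMDiffAt) ?_ ?_ ?_
    · filter_upwards [hℓ.continuous.continuousAt.eventually (c.open_target.mem_nhds hmem)]
        with t ht
      have h1 : ℓ t ∈ W := W.add_mem ((hW p hp).1 hpN) (W.smul_mem t hv)
      rw [← c.right_inv ht] at h1
      exact (hW _ (c.map_target ht)).2 h1
    · simp [hℓ0, c.left_inv hp]
    · rw [mfderiv_comp (0 : ℝ) (hsymm.mdifferentiableAt (by simp))
        (hℓ.contMDiff.contMDiffAt.mdifferentiableAt (by simp)), mfderiv_eq_fderiv]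
      have h1 : fderiv ℝ ℓ 0 1 = h := by
        have : HasDerivAt ℓ ((1 : ℝ) • h) 0 :=
          ((hasDerivAt_id (0 : ℝ)).smul_const h).const_add (c p)
        rw [one_smul] at this
        exact this.deriv
      have h2 := congrArg (fun L => L v) (hmd.symm_comp_deriv hp)
      change _ = mfderiv (𝓡 M.dim) (𝓡 M.dim) c.symm (ℓ 0) (fderiv ℝ ℓ 0 1)
      rw [h1, hℓ0]
      exact h2.symm

/-- The normal space of `N` read in a chart in which `N` is a linear subspace `W`. -/
def normalEquiv (hc : c ∈ IsManifold.maximalAtlas (𝓡 M.dim) ∞ M.carrier)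
    {W : Submodule ℝ (Euc M.dim)} (hW : ∀ q ∈ c.source, q ∈ N ↔ c q ∈ W) {p : M}
    (hp : p ∈ c.source) (hpN : p ∈ N) : Normal M N p ≃ₗ[ℝ] Euc M.dim ⧸ W :=
  Submodule.Quotient.equiv (tangentOf M N p) W (chartDerivEquiv hc hp).toLinearEquiv (by
    ext y
    rw [Submodule.mem_map]
    constructor
    · rintro ⟨v, hv, rfl⟩
      exact (mem_tangentOf_iff hc hW hp hpN v).1 hv
    · intro hy
      refine ⟨(chartDerivEquiv hc hp).symm y, (mem_tangentOf_iff hc hW hp hpN _).2 ?_,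
        (chartDerivEquiv hc hp).apply_symm_apply y⟩
      rw [← chartDerivEquiv_apply hc hp, ContinuousLinearEquiv.apply_symm_apply]
      exact hy)

theorem normalEquiv_toNormal (hc : c ∈ IsManifold.maximalAtlas (𝓡 M.dim) ∞ M.carrier)
    {W : Submodule ℝ (Euc M.dim)} (hW : ∀ q ∈ c.source, q ∈ N ↔ c q ∈ W) {p : M}
    (hp : p ∈ c.source) (hpN : p ∈ N) (v : M.Tangent p) :
    normalEquiv hc hW hp hpN (toNormal M N p v) = W.mkQ (chartDeriv c p v) := rfl

/-- A vector field read in a chart. -/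
def vectorFieldInChart (c : OpenPartialHomeomorph M.carrier (Euc M.dim))
    (s : ∀ q : M, M.Tangent q) (u : Euc M.dim) : Euc M.dim :=
  chartDeriv c (c.symm u) (s (c.symm u))

theorem contDiffOn_vectorFieldInChart
    (hc : c ∈ IsManifold.maximalAtlas (𝓡 M.dim) ∞ M.carrier) {s : ∀ q : M, M.Tangent q}
    {U : Set M} (hs : ContMDiffOn (𝓡 M.dim) (𝓡 M.dim).tangent ∞
      (fun q => (⟨q, s q⟩ : TangentBundle (𝓡 M.dim) M.carrier)) U) :
    ContDiffOn ℝ ∞ (vectorFieldInChart c s) (c.target ∩ c.symm ⁻¹' U) := by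
  have hT : ContMDiffOn (𝓡 M.dim).tangent (𝓡 M.dim).tangent ∞
      (tangentMapWithin (𝓡 M.dim) (𝓡 M.dim) c c.source) _ :=
    (contMDiffOn_of_mem_maximalAtlas hc).contMDiffOn_tangentMapWithin (m := ∞) (by simp)
      c.open_source.uniqueMDiffOn
  have h1 : ContMDiffOn (𝓡 M.dim) (𝓡 M.dim).tangent ∞
      (fun u => (⟨c.symm u, s (c.symm u)⟩ : TangentBundle (𝓡 M.dim) M.carrier))
      (c.target ∩ c.symm ⁻¹' U) :=
    hs.comp ((contMDiffOn_symm_of_mem_maximalAtlas hc).mono inter_subset_left) fun u hu => hu.2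
  have h2 := hT.comp h1 fun u hu => c.map_target hu.1
  have h3 := (contMDiff_snd_tangentBundle_modelSpace (Euc M.dim) (𝓡 M.dim)
    (n := ∞)).comp_contMDiffOn h2
  refine (contMDiffOn_iff_contDiffOn.1 h3).congr fun u hu => ?_
  have h4 := c.map_target hu.1
  have h5 := tangentMapWithin_eq_tangentMap (p := ⟨c.symm u, s (c.symm u)⟩)
    (c.open_source.uniqueMDiffOn _ h4)
    ((mdifferentiable_of_mem_maximalAtlas hc).mdifferentiableAt h4)
  exact (congrArg (fun P : TangentBundle (𝓡 M.dim) (Euc M.dim) => (P.2 : Euc M.dim)) h5).symm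

end Tangent

/-! ### Weighted and adapted charts of an explosive triple. -/

/-- The subspace `y = z = 0` of `ℝⁿ`. -/
def zeroLocus {n : ℕ} (w : Fin n → Fin 3) : Submodule ℝ (Euc n) where
  carrier := {v | ∀ i, w i ≠ 0 → v i = 0}
  add_mem' h h' i hi := by simp [h i hi, h' i hi]
  zero_mem' _ _ := rfl
  smul_mem' t v h i hi := by simp [h i hi]

/-- A smooth chart of `M` with arbitrarily chosen weights of the coordinates. -/
structure WeightedChart (X : ExplosiveTriple.{u}) where
  chart : OpenPartialHomeomorph X.M.carrier (Euc X.M.dim)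
  mem_maximalAtlas : chart ∈ IsManifold.maximalAtlas (𝓡 X.M.dim) ∞ X.M.carrier
  w : Fin X.M.dim → Fin 3

namespace WeightedChart

variable {X : ExplosiveTriple.{u}}

/-- In the coordinates `(x, y, z)` the submanifold `N` is given by `y = z = 0`, and `E` is spanned
by the vectors in the `y` directions. -/
structure IsAdapted (c : WeightedChart X) : Prop where
  mem_N : ∀ q ∈ c.chart.source, q ∈ X.N ↔ c.chart q ∈ zeroLocus c.w
  mem_E : ∀ (q : X.N), q.1 ∈ c.chart.source → ∀ v : X.M.Tangent q.1,
    toNormal X.M X.N q.1 v ∈ X.E q ↔ ∀ i, c.w i = 2 → chartDeriv c.chart q.1 v i = 0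

end WeightedChart

/-- Adapted charts exist around every point of `N`. -/
theorem ExplosiveTriple.exists_isAdapted (X : ExplosiveTriple.{u}) {p : X.M} (hp : p ∈ X.N) :
    ∃ c : WeightedChart X, p ∈ c.chart.source ∧ c.IsAdapted := by
  obtain ⟨φ, hφ, hpφ, W, hW⟩ := X.isSubmanifold p hp
  obtain ⟨U, hU, hpU, r, s, hs, hE⟩ := X.isNormalSubbundle ⟨p, hp⟩
  have hSU : ∀ q ∈ φ.source, ∀ i, vectorFieldInChart φ (s i) (φ q) =
      chartDeriv φ q (s i q) := fun q hq i => by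
    rw [vectorFieldInChart, φ.left_inv hq]
  have hrange : ∀ q (hq : q ∈ φ.source) (hqN : q ∈ X.N),
      (fun i => W.mkQ (vectorFieldInChart φ (s i) (φ q))) =
        normalEquiv hφ hW hq hqN ∘ fun i => toNormal X.M X.N q (s i q) := fun q hq hqN => by
    funext i
    rw [hSU q hq, Function.comp_apply, normalEquiv_toNormal]
  have hO : IsOpen (φ.target ∩ φ.symm ⁻¹' U) := φ.isOpen_inter_preimage_symm hU
  -- The local frame of `E` is read in a chart that flattens `N`; composing that chart with the
  -- straightening of this frame gives the adapted chart.
  obtain ⟨ψ, w, hx, hψO, hψ, hψs, hψW, hψE⟩ := exists_straightening W hO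
    (fun i => vectorFieldInChart φ (s i)) (fun i => contDiffOn_vectorFieldInChart hφ (hs i))
    (x := φ p) ⟨φ.map_source hpφ, by rwa [mem_preimage, φ.left_inv hpφ]⟩ ((hW p hpφ).1 hp) (by
      rw [hrange p hpφ hp]
      exact (hE ⟨p, hp⟩ hpU).1.map' _ (LinearEquiv.ker _))
  have hmem : φ.trans ψ ∈ IsManifold.maximalAtlas (𝓡 X.M.dim) ∞ X.M.carrier := by
    refine OpenPartialHomeomorph.mem_maximalAtlas_of_contMDiffOn _ ?_ ?_
    · refine (contMDiffOn_iff_contDiffOn.2 hψ).comp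
        ((contMDiffOn_of_mem_maximalAtlas hφ).mono ?_) ?_
      · intro q hq
        exact hq.1
      · intro q hq
        exact hq.2
    · refine (contMDiffOn_symm_of_mem_maximalAtlas hφ).comp
        ((contMDiffOn_iff_contDiffOn.2 hψs).mono ?_) ?_
      · intro q hq
        exact hq.1
      · intro q hq
        exact hq.2
  refine ⟨⟨φ.trans ψ, hmem, w⟩, ⟨hpφ, hx⟩, ⟨fun q hq => ?_, fun q hq v => ?_⟩⟩
  · exact (hW q hq.1).trans (hψW _ hq.2)
  · have hqψ : φ q.1 ∈ ψ.source := hq.2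
    have hqU : q.1 ∈ U := by
      have := (hψO hqψ).2
      rwa [mem_preimage, φ.left_inv hq.1] at this
    have hd : chartDeriv (φ.trans ψ) q.1 v = fderiv ℝ ψ (φ q.1) (chartDeriv φ q.1 v) := by
      have h1 := mfderiv_comp (I := 𝓡 X.M.dim) (I' := 𝓡 X.M.dim) (I'' := 𝓡 X.M.dim) q.1
        (g := ψ) (f := φ)
        (((hψ.contDiffAt (ψ.open_source.mem_nhds hqψ)).contMDiffAt).mdifferentiableAt
          (by simp))
        ((mdifferentiable_of_mem_maximalAtlas hφ).mdifferentiableAt hq.1)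
      rw [mfderiv_eq_fderiv] at h1
      exact congrArg (fun L => L v) h1
    rw [(hE q hqU).2]
    simp only [hd]
    rw [← hψE _ hqψ ((hW _ hq.1).1 q.2), hrange q.1 hq.1 q.2, range_comp,
      ← normalEquiv_toNormal hφ hW hq.1 q.2]
    change _ ↔ _ ∈ Submodule.span ℝ ((normalEquiv hφ hW hq.1 q.2).toLinearMap '' _)
    rw [← Submodule.map_span]
    exact ((normalEquiv hφ hW hq.1 q.2).injective.mem_set_image (s := SetLike.coe _)).symm

/-- A chart at `p`, adapted if `p` lies on `N`. -/
theorem ExplosiveTriple.exists_weightedChart (X : ExplosiveTriple.{u}) (p : X.M) :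
    ∃ c : WeightedChart X, p ∈ c.chart.source ∧ (p ∈ X.N → c.IsAdapted) := by
  by_cases hp : p ∈ X.N
  · obtain ⟨c, hc, hc'⟩ := X.exists_isAdapted hp
    exact ⟨c, hc, fun _ => hc'⟩
  · exact ⟨⟨chartAt _ p, IsManifold.chart_mem_maximalAtlas p, 0⟩, mem_chart_source _ p,
      fun h => (hp h).elim⟩

/-- The preferred chart at `p`, adapted if `p` lies on `N`. -/
def ExplosiveTriple.pref (X : ExplosiveTriple.{u}) (p : X.M) : WeightedChart X :=
  (X.exists_weightedChart p).choose

theorem ExplosiveTriple.mem_pref_source (X : ExplosiveTriple.{u}) (p : X.M) :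
    p ∈ (X.pref p).chart.source :=
  (X.exists_weightedChart p).choose_spec.1

theorem ExplosiveTriple.isAdapted_pref (X : ExplosiveTriple.{u}) {p : X.M} (hp : p ∈ X.N) :
    (X.pref p).IsAdapted :=
  (X.exists_weightedChart p).choose_spec.2 hp

namespace ExplosiveChart

variable {X : ExplosiveTriple.{u}}

/-- An explosive chart as a weighted chart defined on all of `M`. -/
theorem exists_weightedChart (c : ExplosiveChart X) [Nonempty X.M.carrier] :
    ∃ c' : WeightedChart X, c'.chart.source = univ ∧ c'.chart.target = c.U ∧
      (∀ p, c'.chart p = c.coord p) ∧ c'.w = c.w ∧ c'.IsAdapted := by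
  have hU : Nonempty c.U := ‹Nonempty X.M.carrier›.map c.coord
  let φ : OpenPartialHomeomorph X.M.carrier (Euc X.M.dim) :=
    c.coord.toHomeomorph.toOpenPartialHomeomorph.trans (c.U.openPartialHomeomorphSubtypeCoe hU)
  have hsource : φ.source = univ := by simp [φ]
  have htarget : φ.target = c.U := by simp [φ]
  have hcoe : ⇑φ = fun p => (c.coord p : Euc X.M.dim) := rfl
  have hφ : ContMDiff (𝓡 X.M.dim) (𝓡 X.M.dim) ∞ φ :=
    contMDiff_subtype_val.comp c.coord.contMDiff
  have hsymm : ∀ u : c.U, φ.symm u = c.coord.symm u := fun u => by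
    have h : φ (c.coord.symm u) = u := by rw [hcoe]; simp
    rw [← h]
    exact φ.left_inv (by simp [hsource])
  have hmem : φ ∈ IsManifold.maximalAtlas (𝓡 X.M.dim) ∞ X.M.carrier := by
    refine OpenPartialHomeomorph.mem_maximalAtlas_of_contMDiffOn _ hφ.contMDiffOn ?_
    intro u hu
    rw [htarget] at hu
    have h1 : ContMDiffAt (𝓡 X.M.dim) (𝓡 X.M.dim) ∞ (fun x : c.U => φ.symm x) ⟨u, hu⟩ := by
      simp only [hsymm]
      exact c.coord.symm.contMDiff.contMDiffAt
    exact (contMDiffAt_subtype_iff.1 h1).contMDiffWithinAt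
  have hN : ∀ q ∈ φ.source, q ∈ X.N ↔ φ q ∈ zeroLocus c.w := fun q _ => c.mem_N q
  refine ⟨⟨φ, hmem, c.w⟩, hsource, htarget, fun p => rfl, rfl, hN, fun q hq v => ?_⟩
  change _ ↔ ∀ i, c.w i = 2 → chartDeriv φ q.1 v i = 0
  have hE := c.E_eq q
  rw [hE, Submodule.mem_map]
  constructor
  · rintro ⟨y, hy, hyv⟩ i hi
    have h1 : y - v ∈ tangentOf X.M X.N q.1 := (Submodule.Quotient.eq _).1 hyv
    have h2 := (mem_tangentOf_iff hmem hN hq q.2 _).1 h1 i (by simp [hi])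
    have h3 : Submodule.span ℝ {e : Euc X.M.dim | ∃ i, c.w i = 1 ∧
        e = EuclideanSpace.single i (1 : ℝ)} ≤
        LinearMap.ker (EuclideanSpace.proj (𝕜 := ℝ) i : Euc X.M.dim →L[ℝ] ℝ).toLinearMap := by
      refine Submodule.span_le.2 ?_
      rintro _ ⟨j, hj, rfl⟩
      have : i ≠ j := by rintro rfl; simp [hi] at hj
      simp [this]
    have h4 : chartDeriv φ q.1 y i = 0 := h3 hy
    rw [map_sub, PiLp.sub_apply, h4, zero_sub, neg_eq_zero] at h2
    exact h2
  · intro hv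
    -- `h` is the `y`-part of the image of `v`. The `z`-part is zero by `hv`, so `h` differs from
    -- that image only in `x` directions, which are tangent to `N`.
    let h : Euc X.M.dim := WithLp.toLp 2 fun i => if c.w i = 1 then chartDeriv φ q.1 v i else 0
    have hD : chartDeriv φ q.1 ((chartDerivEquiv hmem hq).symm h) = h := by
      rw [← chartDerivEquiv_apply hmem hq, ContinuousLinearEquiv.apply_symm_apply]
    refine ⟨(chartDerivEquiv hmem hq).symm h, ?_, ?_⟩
    · change chartDeriv φ q.1 ((chartDerivEquiv hmem hq).symm h) ∈
        Submodule.span ℝ {e : Euc X.M.dim | ∃ i, c.w i = 1 ∧ e = EuclideanSpace.single i (1 : ℝ)}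
      rw [hD]
      have : h = ∑ i, h i • EuclideanSpace.single i (1 : ℝ) := by
        ext j
        simp [Finset.sum_apply, Pi.single_apply]
      rw [this]
      refine Submodule.sum_mem _ fun i _ => ?_
      by_cases hi : c.w i = 1
      · exact Submodule.smul_mem _ _ (Submodule.subset_span ⟨i, hi, rfl⟩)
      · simp [h, hi]
    · refine (Submodule.Quotient.eq _).2 ((mem_tangentOf_iff hmem hN hq q.2 _).2 ?_)
      intro i hi
      rw [map_sub, hD, PiLp.sub_apply]
      by_cases hi1 : c.w i = 1
      · simp [h, hi1]
      · simp [h, hi1, hv i (by omega)]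

end ExplosiveChart

/-! ### Lifts of compatible maps between the explosions of two charts. -/

namespace WeightedChart

variable {X X' X'' : ExplosiveTriple.{u}}

/-- The chart `c` may be used over `ħ`: it is adapted, or `ħ ≠ 0`. -/
def IsGood (c : WeightedChart X) (t : ℝ) : Prop := t ≠ 0 ∨ c.IsAdapted

/-- The double explosion of the chart. -/
def dom (c : WeightedChart X) : Set (Euc X.M.dim × ℝ) :=
  {a | rescale c.w a.2 a.1 ∈ c.chart.target ∧ c.IsGood a.2}

/-- The set is all of `ℝ` for an adapted chart and `ℝ_*` otherwise. -/
theorem isOpen_isGood (c : WeightedChart X) : IsOpen {t | c.IsGood t} := by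
  by_cases h : c.IsAdapted
  · simp [IsGood, h]
  · simpa [IsGood, h] using (isOpen_ne (x := (0 : ℝ)))

theorem isOpen_dom (c : WeightedChart X) : IsOpen c.dom :=
  (c.chart.open_target.preimage (continuous_rescale c.w)).inter
    (c.isOpen_isGood.preimage continuous_snd)

/-- The point of `M` under a point of the double explosion of the chart. -/
def point (c : WeightedChart X) (a : Euc X.M.dim × ℝ) : X.M := c.chart.symm (rescale c.w a.2 a.1)

theorem point_mem_source {c : WeightedChart X} {a : Euc X.M.dim × ℝ} (ha : a ∈ c.dom) :
    c.point a ∈ c.chart.source := c.chart.map_target ha.1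

theorem chart_point {c : WeightedChart X} {a : Euc X.M.dim × ℝ} (ha : a ∈ c.dom) :
    c.chart (c.point a) = rescale c.w a.2 a.1 := c.chart.right_inv ha.1

theorem contMDiffAt_point {c : WeightedChart X} {a : Euc X.M.dim × ℝ} (ha : a ∈ c.dom) :
    ContMDiffAt 𝓘(ℝ, Euc X.M.dim × ℝ) (𝓡 X.M.dim) ∞ c.point a :=
  (contMDiffAt_symm_of_mem_maximalAtlas c.mem_maximalAtlas ha.1).comp a
    (contDiff_rescale c.w).contMDiff.contMDiffAt

theorem point_mem_N {c : WeightedChart X} {a : Euc X.M.dim × ℝ} (ha : a ∈ c.dom)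
    (h0 : a.2 = 0) : c.point a ∈ X.N := by
  have hc : c.IsAdapted := ha.2.resolve_left (not_not.2 h0)
  rw [hc.mem_N _ (point_mem_source ha), chart_point ha, h0]
  exact fun i hi => rescale_zero_apply hi _

/-- The map to `ℝⁿ'` underlying the lift of `φ` to the double explosions of two charts. -/
def localRep (φ : X ⟶ X') (c : WeightedChart X) (c' : WeightedChart X') (v : Euc X.M.dim) :
    Euc X'.M.dim :=
  c'.chart (φ.toFun (c.chart.symm v))

/-- The lift of `φ` to the double explosions of two charts. -/
def lift (φ : X ⟶ X') (c : WeightedChart X) (c' : WeightedChart X') (a : Euc X.M.dim × ℝ) :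
    Euc X'.M.dim × ℝ :=
  (liftFun c.w c'.w (localRep φ c c') a, a.2)

section

variable {φ : X ⟶ X'} {c : WeightedChart X} {c' : WeightedChart X'} {a : Euc X.M.dim × ℝ}

/-- Only `ħ = 0` needs work. There both charts are adapted, and `φ.mapsTo` and `φ.map_E` translate
into the two conditions of `hasLiftAt_of_compatible`. -/
theorem hasLiftAt (ha : a ∈ c.dom) (ha' : φ.toFun (c.point a) ∈ c'.chart.source)
    (hc' : c'.IsGood a.2) : HasLiftAt c.w c'.w (localRep φ c c') a := by
  let U := c.chart.target ∩ c.chart.symm ⁻¹' (φ.toFun ⁻¹' c'.chart.source)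
  have hφ : Continuous φ.toFun := φ.contMDiff.continuous
  have hU : IsOpen U :=
    c.chart.isOpen_inter_preimage_symm (c'.chart.open_source.preimage hφ)
  have hf : ContDiffOn ℝ ∞ (localRep φ c c') U := by
    refine contMDiffOn_iff_contDiffOn.1 ?_
    refine (contMDiffOn_of_mem_maximalAtlas c'.mem_maximalAtlas).comp
      (φ.contMDiff.comp_contMDiffOn
        ((contMDiffOn_symm_of_mem_maximalAtlas c.mem_maximalAtlas).mono ?_)) ?_
    · exact inter_subset_left
    · exact fun u hu => hu.2
  have haU : rescale c.w a.2 a.1 ∈ U := ⟨ha.1, ha'⟩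
  by_cases h0 : a.2 = 0
  swap
  · exact hasLiftAt_of_ne_zero hU hf haU h0
  have hc : c.IsAdapted := ha.2.resolve_left (not_not.2 h0)
  have hc' : c'.IsAdapted := hc'.resolve_left (not_not.2 h0)
  have hN : ∀ u ∈ U, (∀ j, c.w j ≠ 0 → u j = 0) → c.chart.symm u ∈ X.N := fun u hu h => by
    rw [hc.mem_N _ (c.chart.map_target hu.1), c.chart.right_inv hu.1]
    exact h
  refine hasLiftAt_of_compatible hU hf (fun u hu h => ?_) (fun u hu h v hv => ?_) haU
  · exact (hc'.mem_N _ hu.2).1 (φ.mapsTo _ (hN u hu h))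
  · have hp := c.chart.map_target hu.1
    have hpN := hN u hu h
    set p := c.chart.symm u with hpu
    have hup : c.chart p = u := c.chart.right_inv hu.1
    let D := chartDerivEquiv c.mem_maximalAtlas hp
    have hDv : chartDeriv c.chart p (D.symm v) = v := D.apply_symm_apply v
    -- A coordinate vector without `z`-components represents a class in `E`, so `φ.map_E` can be
    -- applied to it.
    have hE : toNormal X.M X.N p (D.symm v) ∈ X.E ⟨p, hpN⟩ := by
      rw [hc.mem_E ⟨p, hpN⟩ hp]
      intro i hi
      change chartDeriv c.chart p (D.symm v) i = 0
      rw [hDv]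
      exact hv i hi
    have hE' := (hc'.mem_E ⟨φ.toFun p, φ.mapsTo p hpN⟩ hu.2 _).1 (φ.map_E ⟨p, hpN⟩ _ hE)
    have hd : fderiv ℝ (localRep φ c c') u v =
        chartDeriv c'.chart (φ.toFun p) (φ.toHom.tangentMap p (D.symm v)) := by
      have h1 : MDifferentiableAt (𝓡 X.M.dim) (𝓡 X.M.dim) c.chart.symm u :=
        (mdifferentiable_of_mem_maximalAtlas c.mem_maximalAtlas).mdifferentiableAt_symm hu.1
      have h2 : MDifferentiableAt (𝓡 X.M.dim) (𝓡 X'.M.dim) φ.toFun (c.chart.symm u) :=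
        φ.contMDiff.mdifferentiableAt (by simp)
      have h3 : MDifferentiableAt (𝓡 X'.M.dim) (𝓡 X'.M.dim) c'.chart
          (φ.toFun (c.chart.symm u)) :=
        (mdifferentiable_of_mem_maximalAtlas c'.mem_maximalAtlas).mdifferentiableAt hu.2
      have h4 := h3.hasMFDerivAt.comp u (h2.hasMFDerivAt.comp u h1.hasMFDerivAt)
      rw [← mfderiv_eq_fderiv]
      refine (congrArg (fun L => L v) h4.mfderiv).trans ?_
      have h6 : D.symm v = mfderiv (𝓡 X.M.dim) (𝓡 X.M.dim) c.chart.symm u v := by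
        rw [← hup]
        rfl
      rw [h6]
      rfl
    rw [hd]
    exact hE'

theorem eventually_lift (ha : a ∈ c.dom) (ha' : φ.toFun (c.point a) ∈ c'.chart.source)
    (hc' : c'.IsGood a.2) :
    ∀ᶠ b in 𝓝 a, ContDiffAt ℝ ∞ (lift φ c c') b ∧
      c'.chart (φ.toFun (c.point b)) = rescale c'.w (lift φ c c' b).2 (lift φ c c' b).1 := by
  filter_upwards [(hasLiftAt ha ha' hc').eventually] with b hb
  exact ⟨hb.1.prodMk contDiffAt_snd, hb.2.symm⟩

theorem contDiffAt_lift (ha : a ∈ c.dom) (ha' : φ.toFun (c.point a) ∈ c'.chart.source)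
    (hc' : c'.IsGood a.2) : ContDiffAt ℝ ∞ (lift φ c c') a :=
  (eventually_lift ha ha' hc').self_of_nhds.1

theorem lift_mem_dom (ha : a ∈ c.dom) (ha' : φ.toFun (c.point a) ∈ c'.chart.source)
    (hc' : c'.IsGood a.2) : lift φ c c' a ∈ c'.dom := by
  refine ⟨?_, hc'⟩
  rw [← (eventually_lift ha ha' hc').self_of_nhds.2]
  exact c'.chart.map_source ha'

theorem point_lift (ha : a ∈ c.dom) (ha' : φ.toFun (c.point a) ∈ c'.chart.source)
    (hc' : c'.IsGood a.2) : c'.point (lift φ c c' a) = φ.toFun (c.point a) := by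
  rw [point, ← (eventually_lift ha ha' hc').self_of_nhds.2, c'.chart.left_inv ha']

end

/-- After applying `δ_ħ` both sides become the coordinates in `c''` of the same point of `X''.M`.
Hence they agree over `ħ ≠ 0` near `a`, and by density and continuity at `a` itself. -/
theorem lift_lift {φ : X ⟶ X'} {ψ : X' ⟶ X''} {c : WeightedChart X} {c' : WeightedChart X'}
    {c'' : WeightedChart X''} {a : Euc X.M.dim × ℝ}
    (ha : a ∈ c.dom) (ha' : φ.toFun (c.point a) ∈ c'.chart.source) (hc' : c'.IsGood a.2)
    (ha'' : ψ.toFun (φ.toFun (c.point a)) ∈ c''.chart.source) (hc'' : c''.IsGood a.2) :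
    lift ψ c' c'' (lift φ c c' a) = lift (φ ≫ ψ) c c'' a := by
  have ha''' : (φ ≫ ψ).toFun (c.point a) ∈ c''.chart.source := ha''
  have hL := lift_mem_dom ha ha' hc'
  have hLp : ψ.toFun (c'.point (lift φ c c' a)) ∈ c''.chart.source := by
    rwa [point_lift ha ha' hc']
  refine Prod.ext ?_ rfl
  have h1 := contDiffAt_lift ha ha' hc'
  have h2 := contDiffAt_lift hL hLp hc''
  have h3 := contDiffAt_lift ha ha''' hc''
  refine eq_of_rescale_eventuallyEq (w := c''.w)
    (G := fun b => (lift ψ c' c'' (lift φ c c' b)).1) (H := fun b => (lift (φ ≫ ψ) c c'' b).1)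
    (h2.continuousAt.comp h1.continuousAt).fst h3.continuousAt.fst ?_
  have hφ : Continuous φ.toFun := φ.contMDiff.continuous
  have hopen : ∀ᶠ b in 𝓝 a, φ.toFun (c.point b) ∈ c'.chart.source :=
    (hφ.continuousAt.comp (contMDiffAt_point ha).continuousAt).eventually
      (c'.chart.open_source.mem_nhds ha')
  filter_upwards [eventually_lift ha ha' hc', eventually_lift ha ha''' hc'',
    h1.continuousAt.eventually (eventually_lift hL hLp hc''), hopen]
    with b hb hb' hb'' hbo _
  have e1 : c'.point (lift φ c c' b) = φ.toFun (c.point b) := by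
    rw [point, ← hb.2, c'.chart.left_inv hbo]
  have e2 := hb''.2
  rw [e1] at e2
  exact e2.symm.trans hb'.2

theorem lift_id {c : WeightedChart X} {a : Euc X.M.dim × ℝ} (ha : a ∈ c.dom) :
    lift (𝟙 X) c c a = a := by
  refine Prod.ext ?_ rfl
  refine liftFun_eq (H := Prod.fst) continuousAt_fst ?_
  filter_upwards [c.isOpen_dom.mem_nhds ha] with b hb
  exact (chart_point hb).symm

end WeightedChart

/-! ### The double explosion as a set, with its induced maps and coordinates. -/

open WeightedChart

variable {X X' X'' : ExplosiveTriple.{u}}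

theorem isGood_pref {p : X.M} {t : ℝ} (h : t = 0 → p ∈ X.N) : (X.pref p).IsGood t := by
  by_cases ht : t = 0
  · exact Or.inr (X.isAdapted_pref (h ht))
  · exact Or.inl ht

/-- The double explosion of `X`. A point over `p` is given by its coordinates with respect to the
preferred chart at `p`. -/
@[ext]
structure DoubleExplosion (X : ExplosiveTriple.{u}) : Type u where
  base : X.M
  coord : Euc X.M.dim × ℝ
  coord_mem : coord ∈ (X.pref base).dom
  point_coord : (X.pref base).point coord = base

namespace DoubleExplosion

theorem base_mem_N (x : DoubleExplosion X) (h : x.coord.2 = 0) : x.base ∈ X.N := by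
  rw [← x.point_coord]
  exact point_mem_N x.coord_mem h

/-- The map of double explosions induced by a compatible map. -/
def map (φ : X ⟶ X') (x : DoubleExplosion X) : DoubleExplosion X' :=
  have h : φ.toFun ((X.pref x.base).point x.coord) ∈ (X'.pref (φ.toFun x.base)).chart.source := by
    rw [x.point_coord]
    exact X'.mem_pref_source _
  have hg : (X'.pref (φ.toFun x.base)).IsGood x.coord.2 :=
    isGood_pref fun h0 => φ.mapsTo _ (x.base_mem_N h0)
  { base := φ.toFun x.base
    coord := lift φ (X.pref x.base) (X'.pref (φ.toFun x.base)) x.coord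
    coord_mem := lift_mem_dom x.coord_mem h hg
    point_coord := by rw [point_lift x.coord_mem h hg, x.point_coord] }

/-- The part of the double explosion covered by a chart. -/
def chartSource (c : WeightedChart X) : Set (DoubleExplosion X) :=
  {x | x.base ∈ c.chart.source ∧ c.IsGood x.coord.2}

theorem mem_chartSource_pref (x : DoubleExplosion X) : x ∈ chartSource (X.pref x.base) :=
  ⟨X.mem_pref_source _, x.coord_mem.2⟩

/-- The coordinates with respect to a chart. -/
def chartFun (c : WeightedChart X) (x : DoubleExplosion X) : Euc X.M.dim × ℝ :=
  lift (𝟙 X) (X.pref x.base) c x.coord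

@[simp]
theorem chartFun_snd (c : WeightedChart X) (x : DoubleExplosion X) :
    (chartFun c x).2 = x.coord.2 := rfl

theorem id_point_mem {c : WeightedChart X} {x : DoubleExplosion X} (hx : x ∈ chartSource c) :
    (𝟙 X : X ⟶ X).toFun ((X.pref x.base).point x.coord) ∈ c.chart.source := by
  rw [x.point_coord]
  exact hx.1

theorem chartFun_mem_dom {c : WeightedChart X} {x : DoubleExplosion X} (hx : x ∈ chartSource c) :
    chartFun c x ∈ c.dom := lift_mem_dom x.coord_mem (id_point_mem hx) hx.2

theorem point_chartFun {c : WeightedChart X} {x : DoubleExplosion X} (hx : x ∈ chartSource c) :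
    c.point (chartFun c x) = x.base :=
  (point_lift x.coord_mem (id_point_mem hx) hx.2).trans x.point_coord

theorem chartFun_pref (x : DoubleExplosion X) : chartFun (X.pref x.base) x = x.coord :=
  lift_id x.coord_mem

/-- In charts, the induced map is the lift of `φ`. -/
theorem chartFun_map (φ : X ⟶ X') {c : WeightedChart X} {c' : WeightedChart X'}
    {x : DoubleExplosion X} (hx : x ∈ chartSource c) (hx' : x.map φ ∈ chartSource c') :
    chartFun c' (x.map φ) = lift φ c c' (chartFun c x) := by
  have hg : (X'.pref (φ.toFun x.base)).IsGood x.coord.2 := (x.map φ).coord_mem.2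
  have h1 : φ.toFun ((X.pref x.base).point x.coord) ∈
      (X'.pref (φ.toFun x.base)).chart.source := by
    rw [x.point_coord]
    exact X'.mem_pref_source _
  have h2 : φ.toFun ((X.pref x.base).point x.coord) ∈ c'.chart.source := by
    rw [x.point_coord]
    exact hx'.1
  refine (lift_lift (ψ := 𝟙 X') x.coord_mem h1 hg h2 hx'.2).trans ?_
  refine Eq.trans ?_ (lift_lift (φ := 𝟙 X) x.coord_mem (id_point_mem hx) hx.2 h2 hx'.2).symm
  rw [Category.comp_id, Category.id_comp]

/-- The point with given coordinates in a chart. -/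
def ofChart (c : WeightedChart X) (a : Euc X.M.dim × ℝ) (ha : a ∈ c.dom) : DoubleExplosion X :=
  have hg : (X.pref (c.point a)).IsGood a.2 := isGood_pref (point_mem_N ha)
  { base := c.point a
    coord := lift (𝟙 X) c (X.pref (c.point a)) a
    coord_mem := lift_mem_dom ha (X.mem_pref_source _) hg
    point_coord := point_lift ha (X.mem_pref_source _) hg }

theorem ofChart_mem_chartSource {c : WeightedChart X} {a : Euc X.M.dim × ℝ} (ha : a ∈ c.dom) :
    ofChart c a ha ∈ chartSource c := ⟨point_mem_source ha, ha.2⟩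

theorem chartFun_ofChart (c : WeightedChart X) {c' : WeightedChart X} {a : Euc X.M.dim × ℝ}
    (ha : a ∈ c.dom) (ha' : ofChart c a ha ∈ chartSource c') :
    chartFun c' (ofChart c a ha) = lift (𝟙 X) c c' a := by
  refine (lift_lift (φ := 𝟙 X) (ψ := 𝟙 X) ha (X.mem_pref_source _)
    (isGood_pref (point_mem_N ha)) ha'.1 ha'.2).trans ?_
  rw [Category.comp_id]

theorem chartFun_ofChart_self (c : WeightedChart X) {a : Euc X.M.dim × ℝ} (ha : a ∈ c.dom) :
    chartFun c (ofChart c a ha) = a := by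
  rw [chartFun_ofChart c ha (ofChart_mem_chartSource ha), lift_id ha]

/-- The coordinates determine the base through `c.point`, and the preferred coordinates are
recovered by lifting the identity back to the preferred chart at that base. -/
theorem chartFun_injOn (c : WeightedChart X) : InjOn (chartFun c) (chartSource c) := by
  intro x hx y hy h
  have hb : x.base = y.base := by rw [← point_chartFun hx, h, point_chartFun hy]
  -- A separate variable `p` for the base avoids rewriting in types that depend on `x.base =
  -- y.base`.
  have key : ∀ z ∈ chartSource c, ∀ p, z.base = p →
      z.coord = lift (𝟙 X) c (X.pref p) (chartFun c z) := by
    rintro z hz p rfl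
    have hm : (𝟙 X : X ⟶ X).toFun ((X.pref z.base).point z.coord) ∈
        (X.pref z.base).chart.source := by
      rw [z.point_coord]
      exact X.mem_pref_source _
    refine Eq.symm ((lift_lift (φ := 𝟙 X) (ψ := 𝟙 X) z.coord_mem (id_point_mem hz) hz.2 hm
      z.coord_mem.2).trans ?_)
    rw [Category.comp_id, lift_id z.coord_mem]
  ext1
  · exact hb
  · rw [key x hx _ rfl, key y hy _ hb.symm, h]

theorem ofChart_chartFun {c : WeightedChart X} {x : DoubleExplosion X} (hx : x ∈ chartSource c) :
    ofChart c (chartFun c x) (chartFun_mem_dom hx) = x :=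
  chartFun_injOn c (ofChart_mem_chartSource _) hx (chartFun_ofChart_self c _)

/-! ### The smooth structure of the double explosion. -/

open Classical in
/-- A chart of the double explosion with values in `ℝⁿ × ℝ`. -/
def chartEquiv [Nonempty (DoubleExplosion X)] (c : WeightedChart X) :
    PartialEquiv (DoubleExplosion X) (Euc X.M.dim × ℝ) where
  toFun := chartFun c
  -- Outside `c.dom` the value is irrelevant; it is the only reason for requiring a point.
  invFun a := if ha : a ∈ c.dom then ofChart c a ha else Classical.arbitrary _
  source := chartSource c
  target := c.dom
  map_source' _ hx := chartFun_mem_dom hx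
  map_target' a ha := by
    rw [dif_pos ha]
    exact ofChart_mem_chartSource ha
  left_inv' x hx := by rw [dif_pos (chartFun_mem_dom hx), ofChart_chartFun hx]
  right_inv' a ha := by rw [dif_pos ha, chartFun_ofChart_self c ha]

theorem chartEquiv_symm_apply [Nonempty (DoubleExplosion X)] (c : WeightedChart X)
    {a : Euc X.M.dim × ℝ} (ha : a ∈ c.dom) : (chartEquiv c).symm a = ofChart c a ha :=
  dif_pos ha

/-- The standard model of `ℝⁿ × ℝ`. -/
def modelEquiv (n : ℕ) : (Euc n × ℝ) ≃L[ℝ] Euc (n + 1) :=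
  -- Any linear isomorphism serves, since it is undone whenever coordinates are read off.
  ContinuousLinearEquiv.ofFinrankEq (by simp)

/-- A chart of the double explosion with values in `ℝⁿ⁺¹`. -/
def modelChart [Nonempty (DoubleExplosion X)] (c : WeightedChart X) :
    PartialEquiv (DoubleExplosion X) (Euc (X.M.dim + 1)) :=
  (chartEquiv c).trans (modelEquiv X.M.dim).toEquiv.toPartialEquiv

/-- The domain of a change of charts. -/
def overlap (c c' : WeightedChart X) : Set (Euc X.M.dim × ℝ) :=
  {a | a ∈ c.dom ∧ c.point a ∈ c'.chart.source ∧ c'.IsGood a.2}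

theorem isOpen_overlap (c c' : WeightedChart X) : IsOpen (overlap c c') := by
  have h1 : ContinuousOn c.point c.dom := fun a ha =>
    (contMDiffAt_point ha).continuousAt.continuousWithinAt
  have h2 := (h1.isOpen_inter_preimage c.isOpen_dom c'.chart.open_source).inter
    (c'.isOpen_isGood.preimage continuous_snd)
  convert h2 using 1
  ext a
  exact ⟨fun h => ⟨⟨h.1, h.2.1⟩, h.2.2⟩, fun h => ⟨h.1.1, h.1.2, h.2⟩⟩

theorem contDiffOn_lift_overlap (c c' : WeightedChart X) :
    ContDiffOn ℝ ∞ (lift (𝟙 X) c c') (overlap c c') := fun _ ha =>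
  (contDiffAt_lift ha.1 ha.2.1 ha.2.2).contDiffWithinAt

section

variable [Nonempty (DoubleExplosion X)]

theorem modelChart_source (c : WeightedChart X) : (modelChart c).source = chartSource c := by
  simp [modelChart, chartEquiv]

theorem modelChart_symm_trans_source (c c' : WeightedChart X) :
    ((modelChart c).symm.trans (modelChart c')).source =
      (modelEquiv X.M.dim).symm ⁻¹' overlap c c' := by
  ext b
  simp only [PartialEquiv.trans_source, modelChart_source]
  constructor
  · rintro ⟨hb, hb'⟩
    have ha : (modelEquiv X.M.dim).symm b ∈ c.dom := by
      simpa [modelChart, chartEquiv] using hb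
    have e : (modelChart c).symm b = ofChart c _ ha := chartEquiv_symm_apply c ha
    rw [mem_preimage, e] at hb'
    exact ⟨ha, hb'.1, hb'.2⟩
  · rintro ⟨ha, hb⟩
    refine ⟨by simpa [modelChart, chartEquiv] using ha, ?_⟩
    have e : (modelChart c).symm b = ofChart c _ ha := chartEquiv_symm_apply c ha
    rw [mem_preimage, e]
    exact hb

theorem modelChart_symm_trans_eqOn (c c' : WeightedChart X) :
    EqOn ((modelChart c).symm.trans (modelChart c'))
      (fun b => modelEquiv X.M.dim (lift (𝟙 X) c c' ((modelEquiv X.M.dim).symm b)))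
      ((modelEquiv X.M.dim).symm ⁻¹' overlap c c') := by
  intro b hb
  have e : (modelChart c).symm b = ofChart c _ hb.1 := chartEquiv_symm_apply c hb.1
  change modelEquiv X.M.dim (chartFun c' ((modelChart c).symm b)) = _
  rw [e, chartFun_ofChart c hb.1 hb.2]

theorem contDiffOn_modelChart_symm_trans (c c' : WeightedChart X) :
    ContDiffOn ℝ ∞ ((modelChart c).symm.trans (modelChart c'))
      ((modelChart c).symm.trans (modelChart c')).source := by
  rw [modelChart_symm_trans_source]
  exact ((modelEquiv X.M.dim).contDiff.comp_contDiffOn ((contDiffOn_lift_overlap c c').comp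
    (modelEquiv X.M.dim).symm.contDiff.contDiffOn fun _ h => h)).congr
      (modelChart_symm_trans_eqOn c c')

end

/-- The charts of the double explosion. -/
def core (X : ExplosiveTriple.{u}) :
    ChartedSpaceCore (Euc (X.M.dim + 1)) (DoubleExplosion X) where
  -- All weighted charts are included; the domains of the non-adapted ones avoid `ħ = 0`. A nonempty
  -- explosion is needed for `modelChart` to make sense.
  atlas := {e | ∃ (_ : Nonempty (DoubleExplosion X)) (c : WeightedChart X), e = modelChart c}
  chartAt x := @modelChart X ⟨x⟩ (X.pref x.base)
  mem_chart_source x := by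
    rw [@modelChart_source X ⟨x⟩]
    exact x.mem_chartSource_pref
  chart_mem_atlas x := ⟨⟨x⟩, _, rfl⟩
  open_source := by
    rintro _ _ ⟨_, c, rfl⟩ ⟨_, c', rfl⟩
    rw [modelChart_symm_trans_source]
    exact (isOpen_overlap c c').preimage (modelEquiv X.M.dim).symm.continuous
  continuousOn_toFun := by
    rintro _ _ ⟨_, c, rfl⟩ ⟨_, c', rfl⟩
    exact (contDiffOn_modelChart_symm_trans c c').continuousOn

instance : TopologicalSpace (DoubleExplosion X) := (core X).toTopologicalSpace

instance : ChartedSpace (Euc (X.M.dim + 1)) (DoubleExplosion X) := (core X).toChartedSpace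

/-- A chart of the double explosion as a homeomorphism. -/
def homeoChart [Nonempty (DoubleExplosion X)] (c : WeightedChart X) :
    OpenPartialHomeomorph (DoubleExplosion X) (Euc (X.M.dim + 1)) :=
  (core X).openPartialHomeomorph (modelChart c) ⟨inferInstance, c, rfl⟩

theorem mem_atlas_iff {e : OpenPartialHomeomorph (DoubleExplosion X) (Euc (X.M.dim + 1))} :
    e ∈ atlas (Euc (X.M.dim + 1)) (DoubleExplosion X) ↔
      ∃ (_ : Nonempty (DoubleExplosion X)) (c : WeightedChart X), e = homeoChart c := by
  constructor
  · intro he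
    obtain ⟨e', ⟨h, c, rfl⟩, he'⟩ := by
      simpa only [mem_iUnion, mem_singleton_iff] using (show e ∈ ⋃ (e : PartialEquiv _ _)
        (he : e ∈ (core X).atlas), {(core X).openPartialHomeomorph e he} from he)
    exact ⟨h, c, he'⟩
  · rintro ⟨h, c, rfl⟩
    change homeoChart c ∈ ⋃ (e : PartialEquiv _ _) (he : e ∈ (core X).atlas),
      {(core X).openPartialHomeomorph e he}
    simp only [mem_iUnion, mem_singleton_iff]
    exact ⟨modelChart c, ⟨h, c, rfl⟩, rfl⟩

instance : IsManifold (𝓡 (X.M.dim + 1)) ∞ (DoubleExplosion X) := by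
  refine isManifold_of_contDiffOn _ _ _ fun e e' he he' => ?_
  obtain ⟨_, c, rfl⟩ := mem_atlas_iff.1 he
  obtain ⟨_, c', rfl⟩ := mem_atlas_iff.1 he'
  have h := contDiffOn_modelChart_symm_trans c c'
  simpa using! h

theorem isOpen_chartSource (c : WeightedChart X) : IsOpen (chartSource c) := by
  rcases isEmpty_or_nonempty (DoubleExplosion X) with h | h
  · rw [eq_empty_of_isEmpty (chartSource c)]
    exact isOpen_empty
  · rw [← modelChart_source c]
    exact (homeoChart c).open_source

theorem contMDiffAt_chartFun {c : WeightedChart X} {x : DoubleExplosion X}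
    (hx : x ∈ chartSource c) :
    ContMDiffAt (𝓡 (X.M.dim + 1)) 𝓘(ℝ, Euc X.M.dim × ℝ) ∞ (chartFun c) x := by
  have : Nonempty (DoubleExplosion X) := ⟨x⟩
  have hmem : homeoChart c ∈ IsManifold.maximalAtlas (𝓡 (X.M.dim + 1)) ∞ (DoubleExplosion X) :=
    IsManifold.subset_maximalAtlas (mem_atlas_iff.2 ⟨this, c, rfl⟩)
  have h1 : ContMDiffAt (𝓡 (X.M.dim + 1)) (𝓡 (X.M.dim + 1)) ∞ (homeoChart c) x :=
    contMDiffAt_of_mem_maximalAtlas hmem (by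
      change x ∈ (modelChart c).source
      rwa [modelChart_source])
  have h2 := ((modelEquiv X.M.dim).symm.contDiff (n := ∞)).contMDiff.contMDiffAt.comp x h1
  refine h2.congr_of_eventuallyEq (Eventually.of_forall fun y => ?_)
  exact ((modelEquiv X.M.dim).symm_apply_apply _).symm

theorem contMDiffAt_chartEquiv_symm [Nonempty (DoubleExplosion X)] {c : WeightedChart X}
    {a : Euc X.M.dim × ℝ} (ha : a ∈ c.dom) :
    ContMDiffAt 𝓘(ℝ, Euc X.M.dim × ℝ) (𝓡 (X.M.dim + 1)) ∞ (chartEquiv c).symm a := by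
  have hmem : homeoChart c ∈ IsManifold.maximalAtlas (𝓡 (X.M.dim + 1)) ∞ (DoubleExplosion X) :=
    IsManifold.subset_maximalAtlas (mem_atlas_iff.2 ⟨inferInstance, c, rfl⟩)
  have hb : modelEquiv X.M.dim a ∈ (homeoChart c).target := by
    change modelEquiv X.M.dim a ∈ (modelChart c).target
    simpa [modelChart, chartEquiv] using ha
  have h1 := contMDiffAt_symm_of_mem_maximalAtlas hmem hb
  have h2 := h1.comp a ((modelEquiv X.M.dim).contDiff (n := ∞)).contMDiff.contMDiffAt
  refine h2.congr_of_eventuallyEq (Eventually.of_forall fun y => ?_)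
  exact congrArg (chartEquiv c).symm ((modelEquiv X.M.dim).symm_apply_apply y).symm

theorem contMDiff_coord_snd :
    ContMDiff (𝓡 (X.M.dim + 1)) 𝓘(ℝ) ∞ fun x : DoubleExplosion X => x.coord.2 := fun x =>
  ContMDiffAt.comp (g := Prod.snd) (f := chartFun (X.pref x.base)) x
    contDiff_snd.contMDiff.contMDiffAt (contMDiffAt_chartFun x.mem_chartSource_pref)

theorem contMDiff_base :
    ContMDiff (𝓡 (X.M.dim + 1)) (𝓡 X.M.dim) ∞ fun x : DoubleExplosion X => x.base := fun x => by
  have hx := x.mem_chartSource_pref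
  refine ((contMDiffAt_point (chartFun_mem_dom hx)).comp x
    (contMDiffAt_chartFun hx)).congr_of_eventuallyEq ?_
  filter_upwards [(isOpen_chartSource _).mem_nhds hx] with y hy
  exact (point_chartFun hy).symm

/-! ### Criteria for smoothness of maps into the double explosion. -/

section

variable {E H Y : Type*} [NormedAddCommGroup E] [NormedSpace ℝ E] [TopologicalSpace H]
  {I : ModelWithCorners ℝ E H} [TopologicalSpace Y] [ChartedSpace H Y]
  {f : Y → DoubleExplosion X} {y : Y}

theorem eventually_mem_chartSource {c : WeightedChart X} (hy : f y ∈ chartSource c)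
    (hb : ContinuousAt (fun y => (f y).base) y) (ht : ContinuousAt (fun y => (f y).coord.2) y) :
    ∀ᶠ z in 𝓝 y, f z ∈ chartSource c :=
  (hb.eventually (c.chart.open_source.mem_nhds hy.1)).and
    (ht.eventually (c.isOpen_isGood.mem_nhds hy.2))

/-- Smoothness of a map to the double explosion can be checked in a chart. -/
theorem contMDiffAt_of_chartFun {c : WeightedChart X} (hy : f y ∈ chartSource c)
    (hb : ContinuousAt (fun y => (f y).base) y)
    (h : ContMDiffAt I 𝓘(ℝ, Euc X.M.dim × ℝ) ∞ (fun y => chartFun c (f y)) y) :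
    ContMDiffAt I (𝓡 (X.M.dim + 1)) ∞ f y := by
  have : Nonempty (DoubleExplosion X) := ⟨f y⟩
  refine ((contMDiffAt_chartEquiv_symm (chartFun_mem_dom hy)).comp y h).congr_of_eventuallyEq ?_
  -- Continuity of `Pr ∘ f` and `ħ ∘ f` keeps `f` inside the chart; `chartFun` is meaningful only
  -- there, so its smoothness alone would not suffice.
  filter_upwards [eventually_mem_chartSource hy hb h.continuousAt.snd] with z hz
  exact ((chartEquiv c).left_inv hz).symm

/-- The equation `c.chart x.base = δ_ħ v` can be solved for `v` when `ħ ≠ 0`, and trivially when all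
weights are `0`, even though `0⁻¹ = 0`. -/
theorem chartFun_fst_eq {c : WeightedChart X} {x : DoubleExplosion X} (hx : x ∈ chartSource c)
    (h : x.coord.2 ≠ 0 ∨ c.w = 0) :
    (chartFun c x).1 = rescale c.w x.coord.2⁻¹ (c.chart x.base) := by
  have h1 : c.chart x.base = rescale c.w x.coord.2 (chartFun c x).1 := by
    rw [← point_chartFun hx, chart_point (chartFun_mem_dom hx), chartFun_snd]
  rw [h1]
  rcases h with h | h
  · rw [rescale_inv_rescale _ h]
  · rw [rescale_of_eq_zero h, rescale_of_eq_zero h]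

/-- Away from `ħ = 0`, and everywhere in charts without coordinates of positive weight, `Pr` and
`ħ` are coordinates on the double explosion. -/
theorem contMDiffAt_of_base (hb : ContMDiffAt I (𝓡 X.M.dim) ∞ (fun y => (f y).base) y)
    (ht : ContMDiffAt I 𝓘(ℝ) ∞ (fun y => (f y).coord.2) y)
    (h : (f y).coord.2 ≠ 0 ∨ (X.pref (f y).base).w = 0) :
    ContMDiffAt I (𝓡 (X.M.dim + 1)) ∞ f y := by
  set c := X.pref (f y).base with hc
  have hy : f y ∈ chartSource c := (f y).mem_chartSource_pref
  refine contMDiffAt_of_chartFun hy hb.continuousAt ?_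
  have hev : ∀ᶠ z in 𝓝 y, (f z).coord.2 ≠ 0 ∨ c.w = 0 := by
    rcases h with h | h
    · filter_upwards [ht.continuousAt.eventually (isOpen_ne.mem_nhds h)] with z hz
      exact Or.inl hz
    · exact Eventually.of_forall fun _ => Or.inr h
  have hcb : ContMDiffAt I (𝓡 X.M.dim) ∞ (fun z => c.chart (f z).base) y :=
    (contMDiffAt_of_mem_maximalAtlas c.mem_maximalAtlas hy.1).comp y hb
  have key : ContMDiffAt I (𝓡 X.M.dim) ∞
      (fun z => rescale c.w (f z).coord.2⁻¹ (c.chart (f z).base)) y := by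
    rcases h with h | h
    · have hinv : ContMDiffAt I 𝓘(ℝ) ∞ (fun z => (f z).coord.2⁻¹) y :=
        (contDiffAt_inv ℝ h).contMDiffAt.comp y ht
      exact (contDiff_rescale c.w).contMDiff.contMDiffAt.comp y (hcb.prodMk_space hinv)
    · simpa only [rescale_of_eq_zero h] using hcb
  refine (key.prodMk_space ht).congr_of_eventuallyEq ?_
  filter_upwards [eventually_mem_chartSource hy hb.continuousAt ht.continuousAt, hev] with z hz hz'
  exact Prod.ext (chartFun_fst_eq hz hz') rfl

end

theorem contMDiff_map (φ : X ⟶ X') :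
    ContMDiff (𝓡 (X.M.dim + 1)) (𝓡 (X'.M.dim + 1)) ∞ (map φ) := fun x => by
  have hx := x.mem_chartSource_pref
  have hx' := (x.map φ).mem_chartSource_pref
  have hb : ContMDiff (𝓡 (X.M.dim + 1)) (𝓡 X'.M.dim) ∞
      (fun x : DoubleExplosion X => (x.map φ).base) := φ.contMDiff.comp contMDiff_base
  refine contMDiffAt_of_chartFun hx' hb.continuous.continuousAt ?_
  have h1 : ContDiffAt ℝ ∞ (lift φ (X.pref x.base) (X'.pref (x.map φ).base))
      (chartFun (X.pref x.base) x) := by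
    refine contDiffAt_lift (chartFun_mem_dom hx) ?_ hx'.2
    rw [point_chartFun hx]
    exact hx'.1
  refine (h1.contMDiffAt.comp x (contMDiffAt_chartFun hx)).congr_of_eventuallyEq ?_
  filter_upwards [(isOpen_chartSource _).mem_nhds hx, eventually_mem_chartSource hx'
    hb.continuous.continuousAt contMDiff_coord_snd.continuous.continuousAt] with z hz hz'
  exact chartFun_map φ hz hz'

/-! ### The functor, its projection, and the clauses of the theorem. -/

/-- The double explosion as a manifold over `ℝ`. -/
def toManOverReal (X : ExplosiveTriple.{u}) : SmoothManOverReal.{u} where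
  man := { carrier := DoubleExplosion X, dim := X.M.dim + 1 }
  ħ x := x.coord.2
  contMDiff_ħ := contMDiff_coord_snd

/-- The double explosion functor. -/
def functor : ExplosiveTriple.{u} ⥤ SmoothManOverReal.{u} where
  obj X := toManOverReal X
  map {X X'} φ := SmoothManOverReal.Hom.mk (P := toManOverReal X) (P' := toManOverReal X')
    { toFun := map φ, contMDiff := contMDiff_map φ } fun _ => rfl
  map_id X := by
    refine SmoothManOverReal.Hom.ext (funext fun x => ?_)
    exact DoubleExplosion.ext rfl (lift_id x.coord_mem)
  map_comp {X X' X''} φ ψ := by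
    refine SmoothManOverReal.Hom.ext (funext fun x => ?_)
    have h1 : φ.toFun ((X.pref x.base).point x.coord) ∈
        (X'.pref (φ.toFun x.base)).chart.source := by
      rw [x.point_coord]
      exact X'.mem_pref_source _
    have h2 : ψ.toFun (φ.toFun ((X.pref x.base).point x.coord)) ∈
        (X''.pref (ψ.toFun (φ.toFun x.base))).chart.source := by
      rw [x.point_coord]
      exact X''.mem_pref_source _
    exact DoubleExplosion.ext rfl (lift_lift x.coord_mem h1 (x.map φ).coord_mem.2 h2
      ((x.map φ).map ψ).coord_mem.2).symm

/-- The projection of the double explosion. -/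
def projection : functor.{u} ⋙ SmoothManOverReal.forget ⟶ ExplosiveTriple.forget where
  app X := SmoothMan.Hom.mk (M := (toManOverReal X).man) (M' := X.M) base contMDiff_base
  naturality _ _ _ := rfl

/-- A chart defined on all of `M` trivializes the double explosion. -/
def chartDiffeomorph [Nonempty (DoubleExplosion X)] (c : WeightedChart X) (hc : c.IsAdapted)
    (hsource : c.chart.source = univ)
    (U : TopologicalSpace.Opens (Euc X.M.dim × ℝ)) (hU : (U : Set (Euc X.M.dim × ℝ)) = c.dom) :
    Diffeomorph (𝓡 (X.M.dim + 1)) 𝓘(ℝ, Euc X.M.dim × ℝ) (DoubleExplosion X) U ∞ :=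
  have hS : ∀ x, x ∈ chartSource c := fun x => ⟨hsource ▸ mem_univ _, Or.inr hc⟩
  have hD : ∀ a : U, a.1 ∈ c.dom := fun a => hU ▸ a.2
  { toFun := fun x => ⟨chartFun c x, (Set.ext_iff.1 hU _).2 (chartFun_mem_dom (hS x))⟩
    invFun := fun a => (chartEquiv c).symm a
    left_inv := fun x => (chartEquiv c).left_inv (hS x)
    right_inv := fun a => Subtype.ext ((chartEquiv c).right_inv (hD a))
    contMDiff_toFun := by
      rw [← ContMDiff.subtypeVal_comp_iff]
      exact fun x => contMDiffAt_chartFun (hS x)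
    contMDiff_invFun := fun a =>
      (contMDiffAt_chartEquiv_symm (hD a)).comp a contMDiff_subtype_val.contMDiffAt }

/-- The point of the double explosion with given images under `Pr` and `ħ`. -/
def ofBase (p : X.M) (t : ℝ) (h : t ≠ 0 ∨ ((X.pref p).w = 0 ∧ (X.pref p).IsAdapted)) :
    DoubleExplosion X :=
  have h' : rescale (X.pref p).w t (rescale (X.pref p).w t⁻¹ ((X.pref p).chart p)) =
      (X.pref p).chart p := by
    rcases h with h | h
    · rw [rescale_rescale_inv _ h]
    -- With all weights `0` the rescaling is the identity for every parameter, so the value of `t⁻¹`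
    -- at `t = 0` does no harm.
    · rw [rescale_of_eq_zero h.1, rescale_of_eq_zero h.1]
  { base := p
    coord := (rescale (X.pref p).w t⁻¹ ((X.pref p).chart p), t)
    coord_mem := ⟨by
      rw [h']
      exact (X.pref p).chart.map_source (X.mem_pref_source p), h.imp id And.right⟩
    point_coord := by
      rw [point, h']
      exact (X.pref p).chart.left_inv (X.mem_pref_source p) }

theorem ofBase_base (x : DoubleExplosion X)
    (h : x.coord.2 ≠ 0 ∨ ((X.pref x.base).w = 0 ∧ (X.pref x.base).IsAdapted)) :
    ofBase x.base x.coord.2 h = x := by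
  refine DoubleExplosion.ext rfl (Prod.ext ?_ rfl)
  conv_rhs => rw [← chartFun_pref x]
  exact (chartFun_fst_eq x.mem_chartSource_pref (h.imp id And.left)).symm

/-- The part of the double explosion over `ħ ≠ 0`. -/
def nonzeroDiffeomorph (X : ExplosiveTriple.{u}) :
    Diffeomorph (𝓡 (toManOverReal X).man.dim) ((𝓡 X.M.dim).prod 𝓘(ℝ)) (toManOverReal X).nonzero
      (X.M.carrier × RStar) ∞ where
  toFun x := (base x.1, ⟨coord x.1 |>.2, x.2⟩)
  invFun y := ⟨ofBase y.1 y.2.1 (Or.inl y.2.2), y.2.2⟩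
  left_inv x := Subtype.ext (ofBase_base x.1 (Or.inl x.2))
  right_inv _ := rfl
  contMDiff_toFun := by
    have hb : ContMDiff (𝓡 (toManOverReal X).man.dim) (𝓡 X.M.dim) ∞
        fun x : (toManOverReal X).man.carrier => base x := contMDiff_base
    refine (hb.comp contMDiff_subtype_val).prodMk ?_
    rw [← ContMDiff.subtypeVal_comp_iff]
    exact (toManOverReal X).contMDiff_ħ.comp contMDiff_subtype_val
  contMDiff_invFun := by
    rw [← ContMDiff.subtypeVal_comp_iff]
    intro y
    refine contMDiffAt_of_base (f := fun y : X.M.carrier × RStar =>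
      ofBase y.1 y.2.1 (Or.inl y.2.2)) contMDiffAt_fst ?_ (Or.inl y.2.2)
    exact (contMDiff_subtype_val.comp contMDiff_snd).contMDiffAt

/-- For `N = M` all coordinates of an adapted chart have weight `0`. -/
theorem pref_w_eq_zero (h : X.N = univ) (p : X.M) : (X.pref p).w = 0 := by
  have hc := X.isAdapted_pref (p := p) (h ▸ mem_univ p)
  set c := X.pref p
  have hp : c.chart p ∈ c.chart.target := c.chart.map_source (X.mem_pref_source p)
  have hz : ∀ v ∈ c.chart.target, v ∈ zeroLocus c.w := fun v hv => by
    have := (hc.mem_N _ (c.chart.map_target hv)).1 (h ▸ mem_univ _)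
    rwa [c.chart.right_inv hv] at this
  funext i
  by_contra hi
  -- Moving a little in the `i`-th direction stays in the chart, hence in `N`; a nonzero weight
  -- would force the displacement `t` to be `0`.
  let ℓ : ℝ → Euc X.M.dim := fun t => c.chart p + t • EuclideanSpace.single i (1 : ℝ)
  have hℓ : Continuous ℓ := by fun_prop
  have hev : ∀ᶠ t in 𝓝 0, ℓ t ∈ c.chart.target :=
    hℓ.continuousAt.eventually (c.chart.open_target.mem_nhds (by simpa [ℓ] using hp))
  obtain ⟨t, ht, ht0⟩ := ((hev.filter_mono nhdsWithin_le_nhds).and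
    (self_mem_nhdsWithin : {t : ℝ | t ≠ 0} ∈ 𝓝[≠] 0)).exists
  have h1 := hz _ ht i hi
  have h2 := hz _ hp i hi
  simp [ℓ, h2] at h1
  exact ht0 h1

/-- The double explosion of a trivial explosive triple. -/
def trivialDiffeomorph (M : SmoothMan.{u}) :
    Diffeomorph (𝓡 ((ExplosiveTriple.trivialObj M).M.dim + 1)) ((𝓡 M.dim).prod 𝓘(ℝ))
      (DoubleExplosion (ExplosiveTriple.trivialObj M)) (M.carrier × ℝ) ∞ :=
  let X := ExplosiveTriple.trivialObj M
  have h : ∀ p : X.M, (X.pref p).w = 0 ∧ (X.pref p).IsAdapted := fun p =>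
    ⟨pref_w_eq_zero rfl p, X.isAdapted_pref (mem_univ p)⟩
  { toFun := fun x => (x.base, x.coord.2)
    invFun := fun y => ofBase (X := X) y.1 y.2 (Or.inr (h y.1))
    left_inv := fun x => ofBase_base x (Or.inr (h x.base))
    right_inv := fun _ => rfl
    contMDiff_toFun := contMDiff_base.prodMk contMDiff_coord_snd
    contMDiff_invFun := fun y => contMDiffAt_of_base
      (f := fun y : M.carrier × ℝ => ofBase (X := X) y.1 y.2 (Or.inr (h y.1)))
      (contMDiffAt_fst (M := M.carrier) (I := 𝓡 M.dim)) contMDiffAt_snd (Or.inr (h y.1).1) }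

/-- Points with different images under `Pr` or `ħ` are separated by these continuous maps. Two
points with the same images lie in the source of one chart, which is injective there with values in
a Hausdorff space. -/
theorem t2Space [T2Space X.M.carrier] : T2Space (DoubleExplosion X) := by
  refine ⟨fun x y hxy => ?_⟩
  by_cases hb : x.base = y.base
  swap
  · exact separated_by_continuous contMDiff_base.continuous hb
  by_cases ht : x.coord.2 = y.coord.2
  swap
  · exact separated_by_continuous contMDiff_coord_snd.continuous ht
  let c := X.pref x.base
  have hx : x ∈ chartSource c := x.mem_chartSource_pref
  have hy : y ∈ chartSource c := ⟨hb ▸ hx.1, ht ▸ hx.2⟩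
  have hne : chartFun c x ≠ chartFun c y := fun h => hxy (chartFun_injOn c hx hy h)
  obtain ⟨u, v, hu, hv, hxu, hyv, huv⟩ := t2_separation hne
  have hc : ContinuousOn (chartFun c) (chartSource c) := fun z hz =>
    (contMDiffAt_chartFun hz).continuousAt.continuousWithinAt
  refine ⟨_, _, hc.isOpen_inter_preimage (isOpen_chartSource c) hu,
    hc.isOpen_inter_preimage (isOpen_chartSource c) hv, ⟨hx, hxu⟩, ⟨hy, hyv⟩, ?_⟩
  exact (huv.preimage (chartFun c)).mono inter_subset_right inter_subset_right

/-- Two countable families of charts are needed: one whose sources cover all base points handles `ħ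
≠ 0`, but its charts may not be adapted. Over `ħ = 0` a second family is taken from preferred charts
at points of `N`, which are adapted. -/
theorem secondCountableTopology [SecondCountableTopology X.M.carrier] :
    SecondCountableTopology (DoubleExplosion X) := by
  obtain ⟨S, hS, hSU⟩ := TopologicalSpace.isOpen_iUnion_countable
    (fun x : DoubleExplosion X => (X.pref x.base).chart.source)
    fun x => (X.pref x.base).chart.open_source
  obtain ⟨T, hT, hTU⟩ := TopologicalSpace.isOpen_iUnion_countable
    (fun x : {x : DoubleExplosion X // x.coord.2 = 0} => (X.pref x.1.base).chart.source)
    fun x => (X.pref x.1.base).chart.open_source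
  refine ChartedSpace.secondCountable_of_countable_cover (Euc (X.M.dim + 1))
    (s := S ∪ Subtype.val '' T) ?_ (hS.union (hT.image _))
  refine eq_univ_of_forall fun x => ?_
  have hsource : ∀ y : DoubleExplosion X,
      (chartAt (Euc (X.M.dim + 1)) y).source = chartSource (X.pref y.base) := fun y => by
    exact @modelChart_source X ⟨y⟩ _
  simp only [mem_iUnion, hsource]
  by_cases h0 : x.coord.2 = 0
  · have hx : x.base ∈ ⋃ x : {x : DoubleExplosion X // x.coord.2 = 0},
        (X.pref x.1.base).chart.source := mem_iUnion.2 ⟨⟨x, h0⟩, X.mem_pref_source _⟩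
    rw [← hTU] at hx
    obtain ⟨y, hy, hxy⟩ := mem_iUnion₂.1 hx
    exact ⟨y, Or.inr ⟨y, hy, rfl⟩, hxy, Or.inr (X.isAdapted_pref (y.1.base_mem_N y.2))⟩
  · have hx : x.base ∈ ⋃ x : DoubleExplosion X, (X.pref x.base).chart.source :=
      mem_iUnion.2 ⟨x, X.mem_pref_source _⟩
    rw [← hSU] at hx
    obtain ⟨y, hy, hxy⟩ := mem_iUnion₂.1 hx
    exact ⟨y, Or.inl hy, hxy, Or.inl h0⟩

/-- The double explosion of an explosive chart. -/
theorem exists_diffeomorph_chartExplosion (c : ExplosiveChart X) :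
    ∃ Θ : Diffeomorph (𝓡 (X.M.dim + 1)) 𝓘(ℝ, Euc X.M.dim × ℝ) (DoubleExplosion X)
        (chartExplosion c.w c.U) ∞,
      ∀ x : DoubleExplosion X, (c.coord x.base : Euc X.M.dim) =
        rescale c.w (Θ x).1.2 (Θ x).1.1 ∧ x.coord.2 = (Θ x).1.2 := by
  rcases isEmpty_or_nonempty (DoubleExplosion X) with hE | hE
  -- Each point of `M` has a point of the explosion above it at `ħ = 1`, so an empty explosion
  -- forces `M`, and with it the chart, to be empty.
  · have hempty : IsEmpty X.M.carrier :=
      ⟨fun p => hE.false (ofBase p 1 (Or.inl one_ne_zero))⟩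
    have : IsEmpty (chartExplosion c.w c.U) := ⟨fun a => hempty.false (c.coord.symm ⟨_, a.2⟩)⟩
    exact ⟨{ toEquiv := Equiv.equivOfIsEmpty _ _
             contMDiff_toFun := fun x => (hE.false x).elim
             contMDiff_invFun := fun a => isEmptyElim a }, fun x => (hE.false x).elim⟩
  · have : Nonempty X.M.carrier := hE.map base
    obtain ⟨c', hsource, htarget, hcoe, hw, hc'⟩ := c.exists_weightedChart
    have hdom : (chartExplosion c.w c.U : Set (Euc X.M.dim × ℝ)) = c'.dom := by
      ext a
      change rescale c.w a.2 a.1 ∈ (c.U : Set _) ↔ _ ∧ _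
      rw [← htarget, ← hw]
      exact (and_iff_left (Or.inr hc')).symm
    refine ⟨chartDiffeomorph c' hc' hsource _ hdom, fun x => ⟨?_, rfl⟩⟩
    have hx : x ∈ chartSource c' := ⟨hsource ▸ mem_univ _, Or.inr hc'⟩
    have h : c'.chart x.base = rescale c'.w (chartFun c' x).2 (chartFun c' x).1 := by
      rw [← point_chartFun hx, chart_point (chartFun_mem_dom hx)]
    rw [← hcoe, h, hw]
    rfl

end DoubleExplosion

end

end Explosion

/-! ### Assembly of the theorem. -/

theorem mainTheorem5 :
    ∃ (𝔼 : Explosion.ExplosiveTriple.{u} ⥤ Explosion.SmoothManOverReal.{u})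
      (Pr : 𝔼 ⋙ Explosion.SmoothManOverReal.forget ⟶ Explosion.ExplosiveTriple.forget),
      -- explosive charts
      (∀ (X : Explosion.ExplosiveTriple.{u}) (c : Explosion.ExplosiveChart X),
        ∃ Θ : Diffeomorph (𝓡 (𝔼.obj X).man.dim) 𝓘(ℝ, EuclideanSpace ℝ (Fin X.M.dim) × ℝ)
            (𝔼.obj X).man.carrier (Explosion.chartExplosion c.w c.U) ∞,
          ∀ p : (𝔼.obj X).man,
            ((c.coord ((Pr.app X).toFun p) : c.U) : EuclideanSpace ℝ (Fin X.M.dim)) =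
              Explosion.rescale c.w (Θ p).1.2 (Θ p).1.1 ∧
            (𝔼.obj X).ħ p = (Θ p).1.2) ∧
      -- trivial explosive triples
      (∃ Θ : ∀ M : Explosion.SmoothMan.{u},
          Diffeomorph (𝓡 (𝔼.obj (Explosion.ExplosiveTriple.trivial.obj M)).man.dim)
            ((𝓡 M.dim).prod 𝓘(ℝ))
            (𝔼.obj (Explosion.ExplosiveTriple.trivial.obj M)).man.carrier
            (M.carrier × ℝ) ∞,
        (∀ (M : Explosion.SmoothMan.{u})
            (p : (𝔼.obj (Explosion.ExplosiveTriple.trivial.obj M)).man),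
          (Θ M p).1 = (Pr.app (Explosion.ExplosiveTriple.trivial.obj M)).toFun p ∧
          (Θ M p).2 = (𝔼.obj (Explosion.ExplosiveTriple.trivial.obj M)).ħ p) ∧
        ∀ (M M' : Explosion.SmoothMan.{u}) (φ : M ⟶ M')
          (p : (𝔼.obj (Explosion.ExplosiveTriple.trivial.obj M)).man),
          Θ M' ((𝔼.map (Explosion.ExplosiveTriple.trivial.map φ)).toFun p) =
            (φ.toFun (Θ M p).1, (Θ M p).2)) ∧
      -- the part over nonzero `ħ`
      (∀ X : Explosion.ExplosiveTriple.{u},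
        ∃ Θ : Diffeomorph (𝓡 (𝔼.obj X).man.dim) ((𝓡 X.M.dim).prod 𝓘(ℝ))
            (𝔼.obj X).nonzero (X.M.carrier × Explosion.RStar) ∞,
          ∀ p : (𝔼.obj X).nonzero,
            (Θ p).1 = (Pr.app X).toFun p.1 ∧ ((Θ p).2 : ℝ) = (𝔼.obj X).ħ p.1) ∧
      -- the Hausdorff property and second countability are inherited
      (∀ X : Explosion.ExplosiveTriple.{u},
        (T2Space X.M.carrier → T2Space (𝔼.obj X).man.carrier) ∧
        (SecondCountableTopology X.M.carrier →
          SecondCountableTopology (𝔼.obj X).man.carrier)) := by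
  refine ⟨Explosion.DoubleExplosion.functor, Explosion.DoubleExplosion.projection,
    fun X c => Explosion.DoubleExplosion.exists_diffeomorph_chartExplosion c,
    -- Naturality is definitional: an induced map acts on bases by `φ` and leaves `ħ` unchanged.
    ⟨Explosion.DoubleExplosion.trivialDiffeomorph, fun M p => ⟨rfl, rfl⟩, fun M M' φ p => rfl⟩,
    fun X => ⟨Explosion.DoubleExplosion.nonzeroDiffeomorph X, fun p => ⟨rfl, rfl⟩⟩,
    fun X => ⟨fun h => ?_, fun h => ?_⟩⟩
  · exact Explosion.DoubleExplosion.t2Space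
  · exact Explosion.DoubleExplosion.secondCountableTopology
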